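/- Let $d\ge 0$ and $m\ge 2$ be integers. Consider the rays of the $m$-ary tree, that is, the infinite words $\cdots x_2x_1x_0$ with letters in $\{0,\dots,m-1\}$, read from right to left. Let $L_{-1}\cong \mathrm{Sym}(m)$ be the group of permutations of the set of rays that act on the first letter $x_0$ only. For $k\ge 0$, a word $w$ of length $k$ in the letters $\{1,\dots,m-1\}$, and $\sigma\in \mathrm{Sym}(m)\wr \mathrm{Sym}(m-1)$ (the automorphisms of the first two levels of the $m$-ary tree that fix $0$ and its children, acting on the two-letter words whose first-read letter is nonzero), let $\lambda_{w,\sigma}$ be the permutation of the rays which, if the first $k$ nonzero letters of a ray form the word $w$, permutes the $(k+1)$-st nonzero letter and the letter read immediately after it by $\sigma$, and otherwise does nothing. Let $L_k$ be the (finite) group generated by all $\lambda_{w,\sigma}$ with $|w|=k$. The group generated by $L_{-1},L_0,\dots,L_d$ is the mother group of degree $d$ on $m$ letters. The infinite fractal mother graph $\mathcal G(d,m,\infty)$ is the connected component of the zero ray $\cdots 000$ in the Schreier graph of the action of this group on the set of rays with the generating set $\bigcup_{k=-1}^{d}L_k$, where generators (hence edges) are counted with multiplicity. If $d\ge 4$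 and $m\ge 2$, or if $d\ge 3$ and $m\ge 3$, then $\mathcal G(d,m,\infty)$ is transient; that is, the simple random walk on it, from any starting vertex, almost surely visits each vertex only finitely many times. -/

import Mathlib

open MeasureTheory

/-! ### Random walks on Schreier graphs -/

/-- The simple graph underlying the Schreier graph of a family `s` of permutations of `X`: distinct
points are adjacent when one of the `s i` maps one of them to the other. -/
def schreierAdj {ι X : Type*} (s : ι → Equiv.Perm X) : SimpleGraph X :=
  SimpleGraph.fromRel fun x y => ∃ i, s i x = y

/-- The vertex set of the connected component of `o` in the Schreier graph of `s`. -/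
def schreierComponent {ι X : Type*} (s : ι → Equiv.Perm X) (o : X) : Set X :=
  ((schreierAdj s).connectedComponentMk o).supp

theorem mem_schreierComponent_apply {ι X : Type*} (s : ι → Equiv.Perm X) (o : X) (i : ι) (x : X) :
    s i x ∈ schreierComponent s o ↔ x ∈ schreierComponent s o := by
  have h : (schreierAdj s).Reachable (s i x) x := by
    by_cases hx : x = s i x
    · rw [← hx]
    · exact (SimpleGraph.Adj.reachable
        (show (schreierAdj s).Adj x (s i x) from ⟨hx, Or.inl ⟨i, rfl⟩⟩)).symm
  simp only [schreierComponent, SimpleGraph.ConnectedComponent.mem_supp_iff,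
    SimpleGraph.ConnectedComponent.eq]
  exact ⟨fun hx => h.symm.trans hx, fun hx => h.trans hx⟩

/-- The connected component of `o` in the Schreier graph of `s`, as a Schreier graph: the labelled
multigraph on the component having, for every vertex `x` and every label `i`, an edge from `x` to
`s i x`. (When the family `s` runs through finitely many groups, as it does below, the edges can be
reversed, and so this is an undirected multigraph.) -/
def schreierRestrict {ι X : Type*} (s : ι → Equiv.Perm X) (o : X) :
    ι → Equiv.Perm (schreierComponent s o) :=
  fun i => (s i).subtypePerm (mem_schreierComponent_apply s o i)

/-- The trajectory started at `x` that follows the edge labelled `ω n` at time `n`. -/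
def schreierWalk {ι V : Type*} (s : ι → Equiv.Perm V) (x : V) (ω : ℕ → ι) : ℕ → V
  | 0 => x
  | n + 1 => s (ω n) (schreierWalk s x ω n)

/-- The law of a sequence of independent uniformly distributed labels. -/
noncomputable def uniformLabels (ι : Type*) [Fintype ι] [Nonempty ι] :
    @Measure (ℕ → ι) (@MeasurableSpace.pi ℕ (fun _ => ι) (fun _ => ⊤)) :=
  letI : MeasurableSpace ι := ⊤
  Measure.infinitePi fun _ : ℕ => (PMF.uniformOfFintype ι).toMeasure

/-- The Schreier graph of `s` is transient: the simple random walk on it (which at every step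
leaves the current vertex along one of the labelled edges there, chosen uniformly at random),
from any starting vertex, almost surely visits any given vertex only finitely often. -/
def IsTransientSchreier {ι V : Type*} [Fintype ι] [Nonempty ι] (s : ι → Equiv.Perm V) : Prop :=
  letI : MeasurableSpace ι := ⊤
  ∀ x y : V, ∀ᵐ ω ∂(uniformLabels ι), {n : ℕ | schreierWalk s x ω n = y}.Finite

/-! ### The level subgroups of the mother groups -/

/-- Infinite words in the alphabet `{0, …, m-1}`; the letter `v 0` is the first one that is read
(the rightmost one, if words are written from right to left). -/
abbrev Ray (m : ℕ) := ℕ → Fin m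

/-- The nonzero letters. -/
abbrev NonzeroLetter (m : ℕ) [NeZero m] := {x : Fin m // x ≠ 0}

/-- The zero ray `⋯000`. -/
def zeroRay (m : ℕ) [NeZero m] : Ray m := fun _ => 0

/-- The group `Sym(m) ≀ Sym(m-1)` of automorphisms of the first two levels of the `m`-ary tree that
fix `0` and its children: the permutations of the words `xy` with `x ≠ 0` that preserve the relation
of having the same parent `x`. -/
def TwoLevelAut (m : ℕ) [NeZero m] : Subgroup (Equiv.Perm (NonzeroLetter m × Fin m)) where
  carrier := {σ | ∀ p q, (σ p).1 = (σ q).1 ↔ p.1 = q.1}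
  one_mem' := fun _ _ => Iff.rfl
  mul_mem' := fun {a b} ha hb p q => (ha (b p) (b q)).trans (hb p q)
  inv_mem' := fun {a} ha p q => by
    have := ha (a⁻¹ p) (a⁻¹ q)
    simpa using this.symm

/-- `p` is the position of the `(k+1)`-st nonzero letter of `v`. -/
def IsNonzeroPos {m : ℕ} [NeZero m] (v : Ray m) (k p : ℕ) : Prop :=
  v p ≠ 0 ∧ Nat.count (fun i => v i ≠ 0) p = k

/-- The word formed by the first `k` nonzero letters of `v` (if `v` has that many). -/
noncomputable def nonzeroPrefix {m : ℕ} [NeZero m] (k : ℕ) (v : Ray m) : Fin k → Fin m :=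
  fun j => v (Nat.nth (fun i => v i ≠ 0) j)

/-- Apply `σ` to the nonzero letter of `v` in position `p` and the letter following it. -/
def applyAt {m : ℕ} [NeZero m] (σ : TwoLevelAut m) (v : Ray m) (p : ℕ) (hp : v p ≠ 0) : Ray m :=
  fun i =>
    if i = p then (σ.1 (⟨v p, hp⟩, v (p + 1))).1
    else if i = p + 1 then (σ.1 (⟨v p, hp⟩, v (p + 1))).2
    else v i

open Classical in
/-- If `v` has at least `k + 1` nonzero letters, the first `k` of them forming the word `u`, then
permute the `(k+1)`-st nonzero letter and the letter following it by `g u`; otherwise do nothing. -/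
noncomputable def levelMap {m k : ℕ} [NeZero m] (g : (Fin k → Fin m) → TwoLevelAut m)
    (v : Ray m) : Ray m :=
  if h : ∃ p, IsNonzeroPos v k p then
    applyAt (g (nonzeroPrefix k v)) v h.choose h.choose_spec.1
  else v

theorem IsNonzeroPos.unique {m : ℕ} [NeZero m] {v : Ray m} {k p q : ℕ}
    (hp : IsNonzeroPos v k p) (hq : IsNonzeroPos v k q) : p = q :=
  Nat.count_injective hp.1 hq.1 (hp.2.trans hq.2.symm)

theorem levelMap_of_pos {m k : ℕ} [NeZero m] (g : (Fin k → Fin m) → TwoLevelAut m)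
    {v : Ray m} {p : ℕ} (hp : IsNonzeroPos v k p) :
    levelMap g v = applyAt (g (nonzeroPrefix k v)) v p hp.1 := by
  have h : ∃ p, IsNonzeroPos v k p := ⟨p, hp⟩
  have hq : h.choose = p := h.choose_spec.unique hp
  rw [levelMap, dif_pos h]
  congr 1

theorem levelMap_of_not {m k : ℕ} [NeZero m] (g : (Fin k → Fin m) → TwoLevelAut m)
    {v : Ray m} (h : ¬ ∃ p, IsNonzeroPos v k p) : levelMap g v = v := by
  rw [levelMap, dif_neg h]

theorem applyAt_one {m : ℕ} [NeZero m] (v : Ray m) (p : ℕ) (hp : v p ≠ 0) :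
    applyAt 1 v p hp = v := by
  funext i
  simp only [applyAt]
  split_ifs with h1 h2
  · subst h1; rfl
  · subst h2; rfl
  · rfl

theorem applyAt_ne_zero {m : ℕ} [NeZero m] (σ : TwoLevelAut m) (v : Ray m) (p : ℕ)
    (hp : v p ≠ 0) : applyAt σ v p hp p ≠ 0 := by
  simpa [applyAt] using (σ.1 (⟨v p, hp⟩, v (p + 1))).1.2

theorem applyAt_mul {m : ℕ} [NeZero m] (σ τ : TwoLevelAut m) (v : Ray m) (p : ℕ)
    (hp : v p ≠ 0) :
    applyAt σ (applyAt τ v p hp) p (applyAt_ne_zero τ v p hp) = applyAt (σ * τ) v p hp := by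
  funext i
  simp [applyAt]
  split_ifs <;> rfl

theorem applyAt_of_lt {m : ℕ} [NeZero m] (σ : TwoLevelAut m) (v : Ray m) (p : ℕ)
    (hp : v p ≠ 0) {i : ℕ} (hi : i < p) : applyAt σ v p hp i = v i := by
  simp [applyAt, hi.ne, (hi.trans (Nat.lt_succ_self p)).ne]

theorem count_congr_below {P Q : ℕ → Prop} [DecidablePred P] [DecidablePred Q] {p : ℕ}
    (h : ∀ i < p, (P i ↔ Q i)) : Nat.count P p = Nat.count Q p := by
  induction p with
  | zero => simp
  | succ n ih =>
    rw [Nat.count_succ, Nat.count_succ, ih fun i hi => h i (hi.trans (Nat.lt_succ_self n))]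
    simp [h n (Nat.lt_succ_self n)]

theorem isNonzeroPos_applyAt {m k : ℕ} [NeZero m] (σ : TwoLevelAut m) {v : Ray m} {p : ℕ}
    (hp : IsNonzeroPos v k p) : IsNonzeroPos (applyAt σ v p hp.1) k p := by
  refine ⟨applyAt_ne_zero σ v p hp.1, ?_⟩
  refine Eq.trans ?_ hp.2
  exact count_congr_below fun i hi => by rw [applyAt_of_lt σ v p hp.1 hi]

theorem nonzeroPrefix_congr {m k : ℕ} [NeZero m] {u v : Ray m} {p : ℕ}
    (hv : IsNonzeroPos v k p) (h : ∀ i < p, u i = v i) :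
    nonzeroPrefix k u = nonzeroPrefix k v := by
  funext j
  have hj : (j : ℕ) < Nat.count (fun i => v i ≠ 0) p := by rw [hv.2]; exact j.2
  have hlt : Nat.nth (fun i => v i ≠ 0) j < p := Nat.nth_lt_of_lt_count hj
  have hne : v (Nat.nth (fun i => v i ≠ 0) j) ≠ 0 := by
    refine Nat.nth_mem (p := fun i => v i ≠ 0) j fun hf => hj.trans_le ?_
    exact Nat.count_le_card hf p
  have hcount : Nat.count (fun i => u i ≠ 0) (Nat.nth (fun i => v i ≠ 0) j) = j := by
    rw [count_congr_below (Q := fun i => v i ≠ 0) fun i hi => by rw [h i (hi.trans hlt)]]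
    refine Nat.count_nth fun hf => hj.trans_le ?_
    exact Nat.count_le_card hf p
  have hn : Nat.nth (fun i => u i ≠ 0) j = Nat.nth (fun i => v i ≠ 0) j := by
    have := Nat.nth_count (p := fun i => u i ≠ 0)
      (show u (Nat.nth (fun i => v i ≠ 0) j) ≠ 0 by rw [h _ hlt]; exact hne)
    rwa [hcount] at this
  simp only [nonzeroPrefix]
  rw [hn, h _ hlt]

theorem levelMap_one {m k : ℕ} [NeZero m] (v : Ray m) :
    levelMap (1 : (Fin k → Fin m) → TwoLevelAut m) v = v := by
  by_cases h : ∃ p, IsNonzeroPos v k p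
  · obtain ⟨p, hp⟩ := h
    rw [levelMap_of_pos _ hp]
    exact applyAt_one v p hp.1
  · exact levelMap_of_not _ h

theorem levelMap_mul {m k : ℕ} [NeZero m] (g h : (Fin k → Fin m) → TwoLevelAut m) (v : Ray m) :
    levelMap g (levelMap h v) = levelMap (g * h) v := by
  by_cases hv : ∃ p, IsNonzeroPos v k p
  · obtain ⟨p, hp⟩ := hv
    rw [levelMap_of_pos h hp, levelMap_of_pos (g * h) hp,
      levelMap_of_pos g (isNonzeroPos_applyAt _ hp),
      nonzeroPrefix_congr hp fun i hi => applyAt_of_lt _ v p hp.1 hi]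
    exact applyAt_mul _ _ v p hp.1
  · rw [levelMap_of_not h hv, levelMap_of_not g hv, levelMap_of_not (g * h) hv]

/-- `levelMap g` as a permutation of the rays; it is multiplicative in `g`. -/
noncomputable def levelHom (m k : ℕ) [NeZero m] :
    ((Fin k → Fin m) → TwoLevelAut m) →* Equiv.Perm (Ray m) where
  toFun g :=
    { toFun := levelMap g
      invFun := levelMap g⁻¹
      left_inv := fun v => by rw [levelMap_mul, inv_mul_cancel, levelMap_one]
      right_inv := fun v => by rw [levelMap_mul, mul_inv_cancel, levelMap_one] }
  map_one' := Equiv.ext levelMap_one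
  map_mul' g h := Equiv.ext fun v => (levelMap_mul g h v).symm

open Classical in
/-- The permutation `λ_{w,σ}`, for a word `w` of `k` nonzero letters: if the first `k` nonzero
letters agree with `w`, then it permutes the `(k+1)`-st nonzero letter and the following letter
by `σ`; otherwise it does nothing. -/
noncomputable def lambdaPerm {m k : ℕ} [NeZero m] (w : Fin k → NonzeroLetter m)
    (σ : TwoLevelAut m) : Equiv.Perm (Ray m) :=
  levelHom m k fun u => if u = fun j => (w j : Fin m) then σ else 1

/-- The group generated by the `λ_{w,σ}` for a given word `w`. -/
noncomputable def wordSubgroup {m k : ℕ} [NeZero m] (w : Fin k → NonzeroLetter m) :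
    Subgroup (Equiv.Perm (Ray m)) :=
  Subgroup.closure (Set.range (lambdaPerm w))

/-- The permutation of the rays that permutes the first letter by `σ`. -/
def firstLetterPerm (m : ℕ) : Equiv.Perm (Fin m) →* Equiv.Perm (Ray m) where
  toFun σ :=
    { toFun := fun v i => if i = 0 then σ (v i) else v i
      invFun := fun v i => if i = 0 then σ⁻¹ (v i) else v i
      left_inv := fun v => by funext i; by_cases h : i = 0 <;> simp [h]
      right_inv := fun v => by funext i; by_cases h : i = 0 <;> simp [h] }
  map_one' := by ext v i; simp
  map_mul' σ τ := by
    ext v i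
    by_cases h : i = 0 <;> simp [h]

/-- The level subgroups, with the index shifted by one: `levelSubgroup m 0` is the group
`L_{-1} = Sym(m)` permuting the first letter, and `levelSubgroup m (k + 1)` is the group `L_k`
generated by the `wordSubgroup w` for all words `w` of `k` nonzero letters. -/
noncomputable def levelSubgroup (m : ℕ) [NeZero m] : ℕ → Subgroup (Equiv.Perm (Ray m))
  | 0 => (firstLetterPerm m).range
  | k + 1 => ⨆ w : Fin k → NonzeroLetter m, wordSubgroup w

theorem finite_levelSubgroup (m : ℕ) [NeZero m] (j : ℕ) : Finite (levelSubgroup m j) := by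
  cases j with
  | zero => exact Set.finite_range (firstLetterPerm m)
  | succ k =>
    have hle : levelSubgroup m (k + 1) ≤ (levelHom m k).range := by
      refine iSup_le fun w => (Subgroup.closure_le _).2 ?_
      rintro _ ⟨σ, rfl⟩
      exact ⟨_, rfl⟩
    have hfin : Finite (levelHom m k).range := Set.finite_range (levelHom m k)
    exact Finite.of_injective _ (Subgroup.inclusion_injective hle)

/-! ### Fractal mother graphs -/

/-- The generators of the mother group of degree `d`: the elements of `L_{-1}, L_0, …, L_d`,
counted with multiplicity (an element lying in several of these groups is counted once for each
of them). -/
abbrev MotherGenerator (d m : ℕ) [NeZero m] := Σ j : Fin (d + 2), levelSubgroup m j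

noncomputable instance (d m : ℕ) [NeZero m] : Fintype (MotherGenerator d m) :=
  haveI := fun j : Fin (d + 2) => finite_levelSubgroup m j
  Fintype.ofFinite _

instance (d m : ℕ) [NeZero m] : Nonempty (MotherGenerator d m) := ⟨⟨0, 1⟩⟩

/-- The generators of the mother group, acting on the boundary of the `m`-ary tree. -/
def motherAction (d m : ℕ) [NeZero m] : MotherGenerator d m → Equiv.Perm (Ray m) :=
  fun g => g.2.1

/-- The infinite fractal mother graph `𝒢(d, m, ∞)`: the connected component of the zero ray in the
Schreier graph of the action on the boundary with the generators `MotherGenerator d m`. -/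
def fractalMotherGraph (d m : ℕ) [NeZero m] :
    MotherGenerator d m → Equiv.Perm (schreierComponent (motherAction d m) (zeroRay m)) :=
  schreierRestrict (motherAction d m) (zeroRay m)

/-! A connected graph is transient once some vertex `o` has finite resistance to infinity, that is,
f(o)² ≤ C · energy(f) for all finitely supported f. Resistances are bounded in this dual form,
without flows: the squared difference of two averages of f is at most a constant times the energy in
a cylinder. Cauchy–Schwarz along a path is the series law; averaging over disjoint subcylinders is
the parallel law.

Fix a nonzero letter b and write [n] for a block of n free letters. Let T(n) bound the resistance
between cylinders [n]ct and [n]c't, and between [n]b0t and [n+1]bt. If the T(n) are summable,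
climbing from b000⋯ through the cylinders [n]b000⋯ has finite cost. The averages of a finitely
supported f over these cylinders tend to 0, so the climb ends at infinity
(`exists_sq_apply_zeroRay_le`).

To bound T(n), write n = p + 1 + k. Spread the first p letters onto a random sparse word with at
most a nonzero letters, and put b after it. If a + 1 ≤ d, the generators can still move the next k
letters as in degree zero, along a line of 2^k words, and then reach the letter at n. About p^a
sparse words do this in parallel, which costs about 2^k p^(-a). Reaching the sparse words costs T(p)
+ s(p), where s(p) is the spreading resistance, but this happens in parallel for the m^k values of
the block, so (`cross_and_ladder_of_spread`) T(n) ≲ (T(p) + s(p)) / m^k + 2^k p^(-a).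

If T(j) ≤ B j^(-4/3) for smaller j, the ladder gives s(p) ≲ B p^(-1/3)
(`spreadBound_succ_of_scaleBound`). With m^k ≈ M n the first term is ≲ (B/M) n^(-4/3). The second is
about n^(-2) for m = 2, a = 3, and at most about n^(-4/3) for m ≥ 3, a = 2; these need d ≥ 4 and d ≥
3. Choosing M large and then B large closes the induction (`exists_scaleBound`). -/

/-! ### Sums over words -/

/-- The sum of a function over the words of length `n` with letters in `A`. -/
noncomputable def wordSum {α : Type*} (A : Finset α) : ℕ → (List α → ℝ) →ₗ[ℝ] ℝ
  | 0 => LinearMap.proj []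
  | n + 1 => ∑ c ∈ A, (wordSum A n).comp (LinearMap.funLeft ℝ ℝ fun y => y ++ [c])

theorem wordSum_zero {α : Type*} (A : Finset α) (φ : List α → ℝ) : wordSum A 0 φ = φ [] := rfl

theorem wordSum_succ {α : Type*} (A : Finset α) (n : ℕ) (φ : List α → ℝ) :
    wordSum A (n + 1) φ = ∑ c ∈ A, wordSum A n fun y => φ (y ++ [c]) := by
  simp [wordSum, LinearMap.funLeft, Function.comp_def]

theorem wordSum_mono {α : Type*} (A : Finset α) (n : ℕ) {φ ψ : List α → ℝ}
    (h : ∀ y, y.length = n → φ y ≤ ψ y) : wordSum A n φ ≤ wordSum A n ψ := by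
  induction n generalizing φ ψ with
  | zero => exact h [] rfl
  | succ n ih =>
    rw [wordSum_succ, wordSum_succ]
    exact Finset.sum_le_sum fun c _ => ih fun y hy => h _ (by simp [hy])

theorem wordSum_nonneg {α : Type*} (A : Finset α) (n : ℕ) {φ : List α → ℝ}
    (h : ∀ y, 0 ≤ φ y) : 0 ≤ wordSum A n φ := by
  simpa using wordSum_mono A n (φ := 0) (ψ := φ) fun y _ => h y

theorem wordSum_le_of_subset {α : Type*} {A B : Finset α} (hAB : A ⊆ B) (n : ℕ)
    {φ : List α → ℝ} (h : ∀ y, 0 ≤ φ y) : wordSum A n φ ≤ wordSum B n φ := by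
  induction n generalizing φ with
  | zero => exact le_rfl
  | succ n ih =>
    rw [wordSum_succ, wordSum_succ]
    exact (Finset.sum_le_sum fun c _ => ih fun y => h _).trans
      (Finset.sum_le_sum_of_subset_of_nonneg hAB fun c _ _ => wordSum_nonneg B n fun y => h _)

theorem wordSum_add_length {α : Type*} (A : Finset α) (p k : ℕ) (φ : List α → ℝ) :
    wordSum A (p + k) φ = wordSum A k fun z => wordSum A p fun y => φ (y ++ z) := by
  induction k generalizing φ with
  | zero => simp [wordSum_zero]
  | succ k ih =>
    rw [← add_assoc, wordSum_succ, wordSum_succ]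
    simp [ih]

/-- Fubini for words. It serves to interchange the average over a block with the sum or sparse mean
over the prefix, which is why these are linear maps. -/
theorem map_wordSum {α β : Type*} (A : Finset α) (n : ℕ) (L : (β → ℝ) →ₗ[ℝ] ℝ)
    (φ : List α → β → ℝ) :
    L (fun y => wordSum A n fun z => φ z y) = wordSum A n fun z => L (φ z) := by
  induction n generalizing φ with
  | zero => rfl
  | succ n ih =>
    simp only [wordSum_succ]
    have : (fun y => ∑ c ∈ A, wordSum A n fun z => φ (z ++ [c]) y) =
        ∑ c ∈ A, fun y => wordSum A n fun z => φ (z ++ [c]) y := by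
      ext y; simp
    rw [this, map_sum]
    exact Finset.sum_congr rfl fun c _ => ih _

theorem wordSum_sub {α : Type*} (A : Finset α) (n : ℕ) (φ ψ : List α → ℝ) :
    (wordSum A n fun y => φ y - ψ y) = wordSum A n φ - wordSum A n ψ :=
  map_sub (wordSum A n) φ ψ

theorem wordSum_mul_left {α : Type*} (A : Finset α) (n : ℕ) (r : ℝ) (φ : List α → ℝ) :
    (wordSum A n fun y => r * φ y) = r * wordSum A n φ :=
  map_smul (wordSum A n) r φ

theorem single_le_wordSum {α : Type*} {A : Finset α} {y : List α} (hy : ∀ c ∈ y, c ∈ A)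
    {φ : List α → ℝ} (h : ∀ y, 0 ≤ φ y) : φ y ≤ wordSum A y.length φ := by
  induction y using List.reverseRecOn generalizing φ with
  | nil => exact le_rfl
  | append_singleton y c ih =>
    rw [List.length_append, List.length_singleton, wordSum_succ]
    refine (ih (φ := fun y => φ (y ++ [c])) (fun c hc => hy c (by simp [hc]))
      fun y => h _).trans ?_
    exact Finset.single_le_sum (f := fun c => wordSum A y.length fun y => φ (y ++ [c]))
      (fun c _ => wordSum_nonneg A _ fun y => h _) (hy c (by simp))

theorem wordSum_append_singleton_le {α : Type*} {A : Finset α} (n : ℕ) {c : α} (hc : c ∈ A)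
    {φ : List α → ℝ} (h : ∀ y, 0 ≤ φ y) :
    (wordSum A n fun y => φ (y ++ [c])) ≤ wordSum A (n + 1) φ := by
  rw [wordSum_succ]
  exact Finset.single_le_sum (f := fun c => wordSum A n fun y => φ (y ++ [c]))
      (fun c _ => wordSum_nonneg A _ fun y => h _) hc

theorem wordSum_sq_le {α : Type*} (A : Finset α) (n : ℕ) {φ ψ : List α → ℝ}
    (h : ∀ y, y.length = n → φ y ^ 2 ≤ ψ y) :
    wordSum A n φ ^ 2 ≤ (A.card : ℝ) ^ n * wordSum A n ψ := by
  induction n generalizing φ ψ with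
  | zero => simpa [wordSum_zero] using h [] rfl
  | succ n ih =>
    rw [wordSum_succ, wordSum_succ]
    refine sq_sum_le_card_mul_sum_sq.trans ?_
    rw [pow_succ', mul_assoc]
    refine mul_le_mul_of_nonneg_left ?_ (by positivity)
    rw [Finset.mul_sum]
    exact Finset.sum_le_sum fun c _ => ih fun y hy => h _ (by simp [hy])

/-- The mean of a function over the words of length `n`. -/
noncomputable def wordMean {α : Type*} (A : Finset α) (n : ℕ) (φ : List α → ℝ) : ℝ :=
  wordSum A n φ / (A.card : ℝ) ^ n

theorem wordMean_zero {α : Type*} (A : Finset α) (φ : List α → ℝ) : wordMean A 0 φ = φ [] := by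
  simp [wordMean, wordSum_zero]

theorem wordMean_succ {α : Type*} (A : Finset α) (n : ℕ) (φ : List α → ℝ) :
    wordMean A (n + 1) φ = (∑ c ∈ A, wordMean A n fun y => φ (y ++ [c])) / A.card := by
  simp only [wordMean, wordSum_succ, ← Finset.sum_div, div_div, pow_succ]

theorem wordMean_sub {α : Type*} (A : Finset α) (n : ℕ) (φ ψ : List α → ℝ) :
    (wordMean A n fun y => φ y - ψ y) = wordMean A n φ - wordMean A n ψ := by
  simp only [wordMean, wordSum_sub, sub_div]

theorem wordMean_add_length {α : Type*} (A : Finset α) (p k : ℕ) (φ : List α → ℝ) :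
    wordMean A (p + k) φ = wordMean A k fun z => wordMean A p fun y => φ (y ++ z) := by
  simp only [wordMean, wordSum_add_length, div_eq_inv_mul, wordSum_mul_left, pow_add, mul_inv]
  ring

theorem map_wordMean {α β : Type*} (A : Finset α) (n : ℕ) (L : (β → ℝ) →ₗ[ℝ] ℝ)
    (φ : List α → β → ℝ) :
    L (fun y => wordMean A n fun z => φ z y) = wordMean A n fun z => L (φ z) := by
  simp only [wordMean, ← map_wordSum, div_eq_inv_mul]
  exact map_smul L _ _

/-- The parallel law: when the ψ y are energies of disjoint cylinders, their sum is at most the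
total energy, and the resistance is divided by the number of words. -/
theorem wordMean_sq_le {α : Type*} {A : Finset α} (hA : A.Nonempty) (n : ℕ) {φ ψ : List α → ℝ}
    (h : ∀ y, y.length = n → φ y ^ 2 ≤ ψ y) :
    wordMean A n φ ^ 2 ≤ wordSum A n ψ / (A.card : ℝ) ^ n := by
  have hpos : (0 : ℝ) < (A.card : ℝ) ^ n := pow_pos (by exact_mod_cast hA.card_pos) n
  rw [wordMean, div_pow, div_le_div_iff₀ (by positivity) hpos]
  nlinarith [wordSum_sq_le A n h]

theorem sq_sum_div_card_le {α : Type*} {A : Finset α} (hA : A.Nonempty) {x y : α → ℝ}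
    (h : ∀ c ∈ A, x c ^ 2 ≤ y c) :
    ((∑ c ∈ A, x c) / A.card) ^ 2 ≤ (∑ c ∈ A, y c) / A.card := by
  have hpos : (0 : ℝ) < A.card := by exact_mod_cast hA.card_pos
  rw [div_pow, div_le_div_iff₀ (by positivity) hpos]
  have h1 : (∑ c ∈ A, x c) ^ 2 ≤ A.card * ∑ c ∈ A, y c :=
    sq_sum_le_card_mul_sum_sq.trans (by gcongr with c hc; exact h c hc)
  nlinarith

/-! ### The resistance of the degree zero moves -/

/-- `ψ` bounds the increments of `φ` under the moves that change the first letter of a word or the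
letter after its first nonzero letter, if this letter is `b`. -/
structure LineBound {α : Type*} (o b : α) (φ ψ : List α → ℝ) : Prop where
  nonneg : ∀ z, 0 ≤ ψ z
  head : ∀ c c' z, (φ (c :: z) - φ (c' :: z)) ^ 2 ≤ ψ (c :: z)
  next : ∀ j c c' z, (φ (List.replicate j o ++ b :: c :: z) -
    φ (List.replicate j o ++ b :: c' :: z)) ^ 2 ≤ ψ (List.replicate j o ++ b :: c :: z)

theorem LineBound.tail {α : Type*} {o b : α} {φ ψ : List α → ℝ} (h : LineBound o b φ ψ)
    (t : List α) : LineBound o b (fun z => φ (z ++ t)) fun z => ψ (z ++ t) where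
  nonneg z := h.nonneg _
  head c c' z := h.head c c' (z ++ t)
  next j c c' z := by simpa using h.next j c c' (z ++ t)

/-- The words in o and b form a line, as in a Gray code: run through the words ending in o, change
the last o to b behind o⋯ob, and run back through the words ending in b. Each word has at most two
edges on the line. The two endpoint terms are subtracted so that the joining edge can be paid for
when two lines are glued. -/
theorem LineBound.abs_sub_le {α : Type*} [DecidableEq α] {o b : α} (hob : o ≠ b)
    {φ ψ : List α → ℝ} (h : LineBound o b φ ψ) (k : ℕ) :
    |φ (List.replicate (k + 1) o) - φ (List.replicate k o ++ [b])| ≤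
      2 * wordSum {o, b} (k + 1) (fun z => √(ψ z)) - √(ψ (List.replicate (k + 1) o)) -
        √(ψ (List.replicate k o ++ [b])) := by
  induction k generalizing φ ψ with
  | zero =>
    have h1 := Real.abs_le_sqrt (h.head o b [])
    rw [wordSum_succ, Finset.sum_pair hob]
    simp only [wordSum_zero, List.nil_append, List.replicate_zero, zero_add, List.replicate_one]
    have := Real.sqrt_nonneg (ψ [b])
    linarith
  | succ k ih =>
    have h0 := ih (h.tail [o])
    have h1 := ih (h.tail [b])
    have h2 := Real.abs_le_sqrt (h.next k o b [])
    rw [wordSum_succ, Finset.sum_pair hob]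
    simp only [← List.replicate_succ', List.append_assoc, List.cons_append,
      List.nil_append] at h0 h1 h2
    have h3 := _root_.abs_sub_le (φ (List.replicate (k + 1 + 1) o))
      (φ (List.replicate k o ++ [b, o])) (φ (List.replicate (k + 1) o ++ [b]))
    have h4 := _root_.abs_sub_le (φ (List.replicate k o ++ [b, o]))
      (φ (List.replicate k o ++ [b, b])) (φ (List.replicate (k + 1) o ++ [b]))
    rw [abs_sub_comm (φ (List.replicate (k + 1) o ++ [b]))] at h1
    have := Real.sqrt_nonneg (ψ (List.replicate k o ++ [b, b]))
    linarith

/-- The last word met on the line `00⋯0, b0⋯0, …` of words of length `k`. -/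
def lineEnd {α : Type*} (o b : α) : ℕ → List α
  | 0 => []
  | k + 1 => List.replicate k o ++ [b]

/-- Cauchy–Schwarz on the 2^k words of the line: the resistance is of the order of its length,
whatever the size of the alphabet. -/
theorem LineBound.sq_sub_lineEnd_le {α : Type*} [Fintype α] [DecidableEq α] {o b : α}
    (hob : o ≠ b) {φ ψ : List α → ℝ} (h : LineBound o b φ ψ) (k : ℕ) :
    (φ (List.replicate k o) - φ (lineEnd o b k)) ^ 2 ≤
      4 * 2 ^ k * wordSum Finset.univ k ψ := by
  cases k with
  | zero => simp [lineEnd, wordSum_zero, h.nonneg]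
  | succ k =>
    have h1 := h.abs_sub_le hob k
    have h2 := wordSum_sq_le {o, b} (k + 1) (φ := fun z => √(ψ z)) (ψ := ψ)
      fun z _ => (Real.sq_sqrt (h.nonneg z)).le
    have h3 := wordSum_le_of_subset (Finset.subset_univ {o, b}) (k + 1) h.nonneg
    rw [Finset.card_pair hob] at h2
    have h4 : |φ (List.replicate (k + 1) o) - φ (lineEnd o b (k + 1))| ≤
        2 * wordSum {o, b} (k + 1) fun z => √(ψ z) := by
      rw [lineEnd]
      linarith [Real.sqrt_nonneg (ψ (List.replicate (k + 1) o)),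
        Real.sqrt_nonneg (ψ (List.replicate k o ++ [b]))]
    have h5 := pow_le_pow_left₀ (abs_nonneg _) h4 2
    rw [sq_abs, mul_pow] at h5
    push_cast at h2
    have h6 : (2 : ℝ) ^ (k + 1) * wordSum {o, b} (k + 1) ψ ≤
        2 ^ (k + 1) * wordSum Finset.univ (k + 1) ψ := by gcongr
    linarith

theorem sq_add_three_le (x y z : ℝ) : (x + y + z) ^ 2 ≤ 3 * (x ^ 2 + y ^ 2 + z ^ 2) := by
  nlinarith [sq_nonneg (x - y), sq_nonneg (y - z), sq_nonneg (x - z)]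

/-- The last letter can be changed directly when b precedes it: go along the line to its end, change
the letter, and come back. The constant is 27 = 3(4 + 1 + 4). -/
theorem LineBound.sq_sub_last_le {α : Type*} [Fintype α] [DecidableEq α] {o b : α}
    (hob : o ≠ b) {φ ψ : List α → ℝ} (h : LineBound o b φ ψ) (k : ℕ) (c : α) :
    (φ (List.replicate k o ++ [c]) - φ (List.replicate k o ++ [o])) ^ 2 ≤
      27 * 2 ^ k * wordSum Finset.univ (k + 1) ψ := by
  cases k with
  | zero =>
    have h1 := h.head c o []
    have h2 := single_le_wordSum (A := Finset.univ) (y := [c]) (by simp) h.nonneg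
    have h3 := h.nonneg [c]
    simp only [List.length_singleton] at h2
    simp only [List.replicate_zero, List.nil_append, pow_zero, zero_add]
    linarith
  | succ k =>
    have hS (c : α) := wordSum_append_singleton_le (A := Finset.univ) (k + 1)
      (Finset.mem_univ c) h.nonneg
    have h0 := (h.tail [c]).sq_sub_lineEnd_le hob (k + 1)
    have h1 := (h.tail [o]).sq_sub_lineEnd_le hob (k + 1)
    have h2 := h.next k c o []
    have h3 := single_le_wordSum (A := Finset.univ) (y := List.replicate k o ++ [b, c])
      (by simp) h.nonneg
    simp only [lineEnd, List.append_assoc, List.cons_append, List.nil_append,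
      List.length_append, List.length_replicate, List.length_cons, List.length_nil] at h0 h1 h2 h3
    have h4 := sq_add_three_le
      (φ (List.replicate (k + 1) o ++ [c]) - φ (List.replicate k o ++ [b, c]))
      (φ (List.replicate k o ++ [b, c]) - φ (List.replicate k o ++ [b, o]))
      (-(φ (List.replicate (k + 1) o ++ [o]) - φ (List.replicate k o ++ [b, o])))
    have h5 (c : α) : 4 * 2 ^ (k + 1) *
        (wordSum Finset.univ (k + 1) fun z => ψ (z ++ [c])) ≤
        4 * 2 ^ (k + 1) * wordSum Finset.univ (k + 1 + 1) ψ := by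
      have := hS c
      gcongr
    have h6 : (1 : ℝ) * wordSum Finset.univ (k + 1 + 1) ψ ≤
        2 ^ (k + 1) * wordSum Finset.univ (k + 1 + 1) ψ := by
      have := wordSum_nonneg Finset.univ (k + 1 + 1) h.nonneg
      gcongr
      exact one_le_pow₀ one_le_two
    have h7 := h5 c
    have h8 := h5 o
    rw [neg_sq] at h4
    rw [show φ (List.replicate (k + 1) o ++ [c]) - φ (List.replicate (k + 1) o ++ [o]) =
      (φ (List.replicate (k + 1) o ++ [c]) - φ (List.replicate k o ++ [b, c])) +
      (φ (List.replicate k o ++ [b, c]) - φ (List.replicate k o ++ [b, o])) +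
      (-(φ (List.replicate (k + 1) o ++ [o]) - φ (List.replicate k o ++ [b, o]))) by ring]
    linarith

/-- Average first inside each class of words with a given last letter, then over the last letter.
The classes have disjoint energies, so the first stage gains a factor of at least 2. This keeps the
growth at 2^k, since 2(54/2 + 27) = 2 · 54. -/
theorem LineBound.sq_mean_sub_le {α : Type*} [Fintype α] [DecidableEq α] {o b : α}
    (hob : o ≠ b) {φ ψ : List α → ℝ} (h : LineBound o b φ ψ) (k : ℕ) :
    (wordMean Finset.univ k φ - φ (List.replicate k o)) ^ 2 ≤
      54 * 2 ^ k * wordSum Finset.univ k ψ := by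
  induction k generalizing φ ψ with
  | zero => simp [wordMean_zero, wordSum_zero, h.nonneg]
  | succ k ih =>
    have hne : (Finset.univ : Finset α).Nonempty := ⟨o, Finset.mem_univ o⟩
    have hcard : (2 : ℝ) ≤ (Finset.univ : Finset α).card := by
      have h1 := Finset.card_le_card (Finset.subset_univ {o, b})
      rw [Finset.card_pair hob] at h1
      exact_mod_cast h1
    have hpos : (0 : ℝ) < (Finset.univ : Finset α).card := by linarith
    have h1 := sq_sum_div_card_le hne fun c _ => ih (h.tail [c])
    have h2 := sq_sum_div_card_le hne fun c _ => h.sq_sub_last_le hob k c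
    have hS := wordSum_nonneg Finset.univ (k + 1) h.nonneg
    rw [Finset.sum_sub_distrib, sub_div] at h1 h2
    rw [Finset.sum_const, nsmul_eq_mul, mul_div_cancel_left₀ _ hpos.ne',
      Finset.sum_const, nsmul_eq_mul, mul_div_cancel_left₀ _ hpos.ne'] at h2
    rw [← wordMean_succ, ← Finset.mul_sum, ← wordSum_succ] at h1
    have h3 : 54 * 2 ^ k * wordSum Finset.univ (k + 1) ψ / (Finset.univ : Finset α).card ≤
        54 * 2 ^ k * wordSum Finset.univ (k + 1) ψ / 2 := by gcongr
    rw [List.replicate_succ', pow_succ' (2 : ℝ) k]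
    nlinarith [sq_nonneg (wordMean Finset.univ (k + 1) φ -
      (∑ c, φ (List.replicate k o ++ [c])) / (Finset.univ : Finset α).card -
      ((∑ c, φ (List.replicate k o ++ [c])) / (Finset.univ : Finset α).card -
        φ (List.replicate k o ++ [o])))]

theorem LineBound.sq_mean_sub_lineEnd_le {α : Type*} [Fintype α] [DecidableEq α] {o b : α}
    (hob : o ≠ b) {φ ψ : List α → ℝ} (h : LineBound o b φ ψ) (k : ℕ) :
    (wordMean Finset.univ k φ - φ (lineEnd o b k)) ^ 2 ≤
      116 * 2 ^ k * wordSum Finset.univ k ψ := by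
  have h1 := h.sq_mean_sub_le hob k
  have h2 := h.sq_sub_lineEnd_le hob k
  nlinarith [sq_nonneg ((wordMean Finset.univ k φ - φ (List.replicate k o)) -
    (φ (List.replicate k o) - φ (lineEnd o b k)))]

/-! ### Energies of disjoint subcylinders -/

theorem wordSum_append_le {α : Type*} [Fintype α] (p : ℕ) (z : List α) {ψ : List α → ℝ}
    (h : ∀ y, 0 ≤ ψ y) :
    (wordSum Finset.univ p fun y => ψ (y ++ z)) ≤ wordSum Finset.univ (p + z.length) ψ := by
  rw [wordSum_add_length]
  exact single_le_wordSum (A := Finset.univ) (y := z)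
    (φ := fun z => wordSum Finset.univ p fun y => ψ (y ++ z)) (by simp)
    fun z => wordSum_nonneg _ _ fun y => h _

/-- The index i is the place of the last nonzero letter, so no word is counted twice. -/
theorem sum_wordSum_append_replicate_le {α : Type*} [Fintype α] {o b : α} (hob : o ≠ b) (p : ℕ)
    {ψ : List α → ℝ} (h : ∀ y, 0 ≤ ψ y) :
    ∑ i ∈ Finset.range (p + 1),
      (wordSum Finset.univ i fun y => ψ (y ++ b :: List.replicate (p - i) o)) ≤
        wordSum Finset.univ (p + 1) ψ := by
  classical
  induction p generalizing ψ with
  | zero =>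
    simpa using wordSum_append_singleton_le (A := Finset.univ) 0 (Finset.mem_univ b) h
  | succ p ih =>
    have h1 := ih (ψ := fun y => ψ (y ++ [o])) fun y => h _
    have h2 : ∀ i ∈ Finset.range (p + 1),
        (wordSum Finset.univ i fun y => ψ (y ++ b :: List.replicate (p + 1 - i) o)) =
        wordSum Finset.univ i fun y => ψ (y ++ b :: List.replicate (p - i) o ++ [o]) := by
      intro i hi
      rw [Finset.mem_range] at hi
      rw [show p + 1 - i = p - i + 1 by omega, List.replicate_succ']
      simp
    rw [Finset.sum_range_succ, Finset.sum_congr rfl h2, wordSum_succ (n := p + 1)]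
    have h3 := Finset.sum_le_sum_of_subset_of_nonneg (Finset.subset_univ {o, b})
      (f := fun c => wordSum Finset.univ (p + 1) fun y => ψ (y ++ [c]))
      fun c _ _ => wordSum_nonneg _ _ fun y => h _
    rw [Finset.sum_pair hob] at h3
    simp only [Nat.sub_self, List.replicate_zero]
    linarith

/-! ### Words and rays -/

/-- The ray with first letter `c`, followed by `t`. -/
def consRay {m : ℕ} (c : Fin m) (t : Ray m) : Ray m
  | 0 => c
  | i + 1 => t i

/-- The ray that starts with the word `y`, followed by `t`. -/
def appRay {m : ℕ} (y : List (Fin m)) (t : Ray m) : Ray m := y.foldr consRay t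

@[simp] theorem appRay_nil {m : ℕ} (t : Ray m) : appRay [] t = t := rfl

@[simp] theorem appRay_cons {m : ℕ} (c : Fin m) (y : List (Fin m)) (t : Ray m) :
    appRay (c :: y) t = consRay c (appRay y t) := rfl

@[simp] theorem appRay_append {m : ℕ} (y z : List (Fin m)) (t : Ray m) :
    appRay (y ++ z) t = appRay y (appRay z t) := List.foldr_append

/-- The number of nonzero letters of a word. -/
def numNonzero {m : ℕ} [NeZero m] (y : List (Fin m)) : ℕ := y.countP fun c => c ≠ 0

theorem numNonzero_append {m : ℕ} [NeZero m] (y z : List (Fin m)) :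
    numNonzero (y ++ z) = numNonzero y + numNonzero z := List.countP_append

theorem numNonzero_replicate_zero {m : ℕ} [NeZero m] (k : ℕ) :
    numNonzero (List.replicate k (0 : Fin m)) = 0 := by
  simp [numNonzero, List.countP_replicate]

theorem numNonzero_cons_le {m : ℕ} [NeZero m] (b : Fin m) (y : List (Fin m)) :
    numNonzero (b :: y) ≤ numNonzero y + 1 := by
  unfold numNonzero
  rw [List.countP_cons]
  split_ifs <;> omega

/-- `e` bounds the increments of `f` under the moves that change the first letter of a ray or the
letter after one of its first `d + 1` nonzero letters. -/
structure EdgeBound {m : ℕ} [NeZero m] (d : ℕ) (f e : Ray m → ℝ) : Prop where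
  nonneg : ∀ t, 0 ≤ e t
  head : ∀ c c' t, (f (consRay c t) - f (consRay c' t)) ^ 2 ≤ e (consRay c t)
  next : ∀ y b c c' t, numNonzero y ≤ d → b ≠ 0 →
    (f (appRay y (consRay b (consRay c t))) - f (appRay y (consRay b (consRay c' t)))) ^ 2 ≤
      e (appRay y (consRay b (consRay c t)))

/-- The mean of `f` over the rays that agree with `t` after the first `n` letters. -/
noncomputable def cylMean {m : ℕ} (f : Ray m → ℝ) (n : ℕ) (t : Ray m) : ℝ :=
  wordMean Finset.univ n fun y => f (appRay y t)

/-- The sum of `e` over the rays that agree with `t` after the first `n` letters. -/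
noncomputable def cylSum {m : ℕ} (e : Ray m → ℝ) (n : ℕ) (t : Ray m) : ℝ :=
  wordSum Finset.univ n fun y => e (appRay y t)

theorem cylMean_zero {m : ℕ} (f : Ray m → ℝ) (t : Ray m) : cylMean f 0 t = f t := wordMean_zero _ _

theorem cylMean_succ {m : ℕ} (f : Ray m → ℝ) (n : ℕ) (t : Ray m) :
    cylMean f (n + 1) t = (∑ c, cylMean f n (consRay c t)) / m := by
  simp [cylMean, wordMean_succ]

theorem cylMean_add_length {m : ℕ} (f : Ray m → ℝ) (p k : ℕ) (t : Ray m) :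
    cylMean f (p + k) t = wordMean Finset.univ k fun z => cylMean f p (appRay z t) := by
  simp [cylMean, wordMean_add_length]

theorem cylSum_add_length {m : ℕ} (e : Ray m → ℝ) (p k : ℕ) (t : Ray m) :
    cylSum e (p + k) t = wordSum Finset.univ k fun z => cylSum e p (appRay z t) := by
  simp [cylSum, wordSum_add_length]

theorem cylSum_nonneg {m : ℕ} {e : Ray m → ℝ} (he : ∀ t, 0 ≤ e t) (n : ℕ) (t : Ray m) :
    0 ≤ cylSum e n t := wordSum_nonneg _ _ fun _ => he _

theorem cylSum_consRay_le {m : ℕ} {e : Ray m → ℝ} (he : ∀ t, 0 ≤ e t) (n : ℕ) (c : Fin m)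
    (t : Ray m) : cylSum e n (consRay c t) ≤ cylSum e (n + 1) t := by
  simpa [cylSum] using wordSum_append_le n [c] (ψ := fun y => e (appRay y t)) fun y => he _

/-- `R` bounds the resistance between two cylinders that differ in the letter at `n`. -/
def CrossBound (d m : ℕ) [NeZero m] (n : ℕ) (R : ℝ) : Prop :=
  ∀ f e : Ray m → ℝ, EdgeBound d f e → ∀ t c c',
    (cylMean f n (consRay c t) - cylMean f n (consRay c' t)) ^ 2 ≤ R * cylSum e (n + 1) t

/-- `T` bounds the resistance between the cylinders in which the last nonzero letter `b` is at `n`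
and at `n + 1`. -/
def LadderBound (d : ℕ) {m : ℕ} [NeZero m] (b : Fin m) (n : ℕ) (T : ℝ) : Prop :=
  ∀ f e : Ray m → ℝ, EdgeBound d f e → ∀ t,
    (cylMean f n (consRay b (consRay 0 t)) - cylMean f (n + 1) (consRay b t)) ^ 2 ≤
      T * (cylSum e n (consRay b (consRay 0 t)) + cylSum e (n + 1) (consRay b t))

/-- The mean over a random word of length `p` with at most `a` nonzero letters: the last nonzero
letter is `b`, at a uniformly distributed place of the second half of the word, and the word before
it is of the same type. -/
noncomputable def sparseMean {m : ℕ} [NeZero m] (b : Fin m) :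
    ℕ → ℕ → (List (Fin m) → ℝ) →ₗ[ℝ] ℝ
  | 0, p => LinearMap.proj (List.replicate p 0)
  | _ + 1, 0 => LinearMap.proj []
  | a + 1, p + 1 => ((Finset.Ico ((p + 1) / 2) (p + 1)).card : ℝ)⁻¹ •
      ∑ i ∈ Finset.Ico ((p + 1) / 2) (p + 1),
        (sparseMean b a i).comp (LinearMap.funLeft ℝ ℝ fun y => y ++ b :: List.replicate (p - i) 0)

theorem sparseMean_zero {m : ℕ} [NeZero m] (b : Fin m) (p : ℕ) (φ : List (Fin m) → ℝ) :
    sparseMean b 0 p φ = φ (List.replicate p 0) := by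
  simp [sparseMean]

theorem sparseMean_length_zero {m : ℕ} [NeZero m] (b : Fin m) (a : ℕ) (φ : List (Fin m) → ℝ) :
    sparseMean b a 0 φ = φ [] := by
  cases a <;> simp [sparseMean]

theorem sparseMean_succ_succ {m : ℕ} [NeZero m] (b : Fin m) (a p : ℕ) (φ : List (Fin m) → ℝ) :
    sparseMean b (a + 1) (p + 1) φ = (∑ i ∈ Finset.Ico ((p + 1) / 2) (p + 1),
      sparseMean b a i fun y => φ (y ++ b :: List.replicate (p - i) 0)) /
        (Finset.Ico ((p + 1) / 2) (p + 1)).card := by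
  simp [sparseMean, LinearMap.funLeft, Function.comp_def, div_eq_inv_mul]

/-- `q` bounds the sum of the squares of the probabilities in `sparseMean b a p`. -/
def SparseMassBound {m : ℕ} [NeZero m] (b : Fin m) (a p : ℕ) (q : ℝ) : Prop :=
  ∀ φ ψ : List (Fin m) → ℝ, (∀ y, 0 ≤ ψ y) →
    (∀ y, y.length = p → numNonzero y ≤ a → φ y ^ 2 ≤ ψ y) →
      sparseMean b a p φ ^ 2 ≤ q * wordSum Finset.univ p ψ

/-- `s` bounds the resistance between a cylinder and its sparse words. -/
def SpreadBound (d : ℕ) {m : ℕ} [NeZero m] (b : Fin m) (a p : ℕ) (s : ℝ) : Prop :=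
  ∀ f e : Ray m → ℝ, EdgeBound d f e → ∀ t,
    (cylMean f p t - sparseMean b a p fun y => f (appRay y t)) ^ 2 ≤ s * cylSum e p t

/-! ### Collision probabilities of sparse words -/

theorem sparseMassBound_zero {m : ℕ} [NeZero m] (b : Fin m) (p : ℕ) :
    SparseMassBound b 0 p 1 := by
  intro φ ψ hψ h
  rw [sparseMean_zero, one_mul]
  refine (h _ List.length_replicate (numNonzero_replicate_zero p).le).trans ?_
  simpa using single_le_wordSum (A := Finset.univ) (y := List.replicate p 0) (by simp) hψ

theorem sparseMassBound_length_zero {m : ℕ} [NeZero m] (b : Fin m) (a : ℕ) :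
    SparseMassBound b a 0 1 := by
  intro φ ψ _ h
  rw [sparseMean_length_zero, one_mul, wordSum_zero]
  exact h [] rfl (by simp [numNonzero])

theorem SparseMassBound.mono {m : ℕ} [NeZero m] {b : Fin m} {a p : ℕ} {q q' : ℝ}
    (h : SparseMassBound b a p q) (hq : q ≤ q') : SparseMassBound b a p q' :=
  fun φ ψ hψ h' => (h φ ψ hψ h').trans
    (mul_le_mul_of_nonneg_right hq (wordSum_nonneg _ _ hψ))

theorem SpreadBound.mono {d m : ℕ} [NeZero m] {b : Fin m} {a p : ℕ} {s s' : ℝ}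
    (h : SpreadBound d b a p s) (hs : s ≤ s') : SpreadBound d b a p s' :=
  fun f e he t => (h f e he t).trans
    (mul_le_mul_of_nonneg_right hs (cylSum_nonneg he.nonneg _ _))

theorem nonempty_Ico_half (p : ℕ) : (Finset.Ico ((p + 1) / 2) (p + 1)).Nonempty :=
  Finset.nonempty_Ico.2 (by omega)

theorem sum_wordSum_Ico_half_le {m : ℕ} [NeZero m] {b : Fin m} (hb : b ≠ 0) (p : ℕ)
    {ψ : List (Fin m) → ℝ} (h : ∀ y, 0 ≤ ψ y) :
    ∑ i ∈ Finset.Ico ((p + 1) / 2) (p + 1),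
      (wordSum Finset.univ i fun y => ψ (y ++ b :: List.replicate (p - i) 0)) ≤
        wordSum Finset.univ (p + 1) ψ := by
  refine le_trans (Finset.sum_le_sum_of_subset_of_nonneg (fun i hi => ?_) fun i _ _ => ?_)
    (sum_wordSum_append_replicate_le hb.symm p h)
  · exact Finset.mem_range.2 (Finset.mem_Ico.1 hi).2
  · exact wordSum_nonneg _ _ fun y => h _

/-- Two sparse words coincide only if their last nonzero letters are at the same place, so the
collision probability is divided by the number of places. -/
theorem SparseMassBound.succ {m : ℕ} [NeZero m] {b : Fin m} (hb : b ≠ 0) {a p : ℕ} {q : ℝ}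
    (hq : 0 ≤ q) (h : ∀ i ∈ Finset.Ico ((p + 1) / 2) (p + 1), SparseMassBound b a i q) :
    SparseMassBound b (a + 1) (p + 1) (q / (Finset.Ico ((p + 1) / 2) (p + 1)).card) := by
  intro φ ψ hψ hφ
  rw [sparseMean_succ_succ]
  refine (sq_sum_div_card_le (nonempty_Ico_half p) fun i hi => h i hi _
    (fun y => ψ (y ++ b :: List.replicate (p - i) 0)) (fun y => hψ _) fun y hy hy' => ?_).trans ?_
  · have hi' := (Finset.mem_Ico.1 hi).2
    refine hφ _ (by simp [hy]; omega) ?_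
    rw [numNonzero_append]
    have h1 := numNonzero_cons_le b (List.replicate (p - i) 0)
    rw [numNonzero_replicate_zero] at h1
    omega
  · rw [← Finset.mul_sum, div_mul_eq_mul_div]
    gcongr
    exact sum_wordSum_Ico_half_le hb p hψ

/-! ### From the spread on one scale to the resistance on the next -/

/-- At the end of the line the block is adjacent to the next letter through a b; for k = 0 this is
the b in front of the empty block. Hence the letter beyond the block can be moved. -/
theorem exists_cons_lineEnd_eq {m : ℕ} [NeZero m] (b : Fin m) (k : ℕ) :
    ∃ u, b :: lineEnd 0 b k = u ++ [b] ∧ numNonzero u ≤ 1 := by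
  cases k with
  | zero => exact ⟨[], rfl, by simp [numNonzero]⟩
  | succ k =>
    refine ⟨b :: List.replicate k 0, rfl, ?_⟩
    simpa [numNonzero_replicate_zero] using numNonzero_cons_le b (List.replicate k 0)

theorem length_lineEnd {α : Type*} (o b : α) (k : ℕ) : (lineEnd o b k).length = k := by
  cases k <;> simp [lineEnd]

/-- Here the degree enters: behind the prefix y and b, a letter following the first nonzero letter
of z has `numNonzero y + 1` nonzero letters before that one, and the generators reach it if this is
at most d. -/
theorem EdgeBound.lineBound {d m : ℕ} [NeZero m] {f e : Ray m → ℝ} (h : EdgeBound d f e)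
    {b : Fin m} (hb : b ≠ 0) {y : List (Fin m)} (hy : numNonzero y + 1 ≤ d) (t : Ray m) :
    LineBound 0 b (fun z => f (appRay (y ++ b :: z) t)) fun z => e (appRay (y ++ b :: z) t) where
  nonneg z := h.nonneg _
  head c c' z := by simpa using h.next y b c c' (appRay z t) (by omega) hb
  next j c c' z := by
    have h1 := numNonzero_cons_le b (List.replicate j 0)
    rw [numNonzero_replicate_zero] at h1
    simpa using h.next (y ++ b :: List.replicate j 0) b c c' (appRay z t)
      (by rw [numNonzero_append]; omega) hb

theorem CrossBound.sq_sub_le {d m : ℕ} [NeZero m] {n : ℕ} {R : ℝ} (hR : CrossBound d m n R)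
    {f e : Ray m → ℝ} (he : EdgeBound d f e) (c : Fin m) (t : Ray m) :
    (cylMean f (n + 1) t - cylMean f n (consRay c t)) ^ 2 ≤ R * cylSum e (n + 1) t := by
  have hm : (m : ℝ) ≠ 0 := by exact_mod_cast NeZero.ne m
  have hne : (Finset.univ : Finset (Fin m)).Nonempty := ⟨c, Finset.mem_univ c⟩
  have h := sq_sum_div_card_le hne (x := fun c' => cylMean f n (consRay c' t) -
    cylMean f n (consRay c t)) (y := fun _ => R * cylSum e (n + 1) t) fun c' _ => hR f e he t c' c
  simpa [sub_div, ← cylMean_succ, hm] using h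

/-- Three stages: make the letter at p equal to b, spread the first p letters onto sparse words, and
bring the block of k letters to x. The first two run in parallel over the m^k blocks, the third in
parallel over the sparse words, whence the factor q. -/
theorem sq_sub_sparseMean_le {d m : ℕ} [NeZero m] {b : Fin m} (hb : b ≠ 0) {a p k : ℕ}
    (had : a + 1 ≤ d) {R s q : ℝ} (hR : CrossBound d m p R) (hs : SpreadBound d b a p s)
    (hs0 : 0 ≤ s) (hq0 : 0 ≤ q) (hq : SparseMassBound b a p q) {f e : Ray m → ℝ}
    (he : EdgeBound d f e) (t : Ray m) {x : List (Fin m)}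
    (hx : x = List.replicate k 0 ∨ x = lineEnd 0 b k) :
    (cylMean f (p + 1 + k) t - sparseMean b a p fun y => f (appRay (y ++ b :: x) t)) ^ 2 ≤
      3 * ((R + s) / m ^ k + 116 * 2 ^ k * q) * cylSum e (p + 1 + k) t := by
  have hne : (Finset.univ : Finset (Fin m)).Nonempty := ⟨b, Finset.mem_univ b⟩
  have hm : (0 : ℝ) < m := by exact_mod_cast NeZero.pos m
  have h1 : (wordMean Finset.univ k fun z => cylMean f (p + 1) (appRay z t) -
      cylMean f p (consRay b (appRay z t))) ^ 2 ≤ R / m ^ k * cylSum e (p + 1 + k) t := by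
    refine (wordMean_sq_le hne k fun z _ => hR.sq_sub_le he b (appRay z t)).trans ?_
    rw [wordSum_mul_left, cylSum_add_length]
    simp [mul_div_right_comm]
  have h2 : (wordMean Finset.univ k fun z => cylMean f p (consRay b (appRay z t)) -
      sparseMean b a p fun y => f (appRay (y ++ b :: z) t)) ^ 2 ≤
        s / m ^ k * cylSum e (p + 1 + k) t := by
    refine (wordMean_sq_le hne k (ψ := fun z => s * cylSum e (p + 1) (appRay z t))
      fun z _ => ?_).trans ?_
    · refine le_trans ?_ (mul_le_mul_of_nonneg_left
        (cylSum_consRay_le he.nonneg p b (appRay z t)) hs0)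
      simpa using hs f e he (consRay b (appRay z t))
    · rw [wordSum_mul_left, cylSum_add_length]
      simp [mul_div_right_comm]
  have h3 : (sparseMean b a p fun y => (wordMean Finset.univ k fun z =>
      f (appRay (y ++ b :: z) t)) - f (appRay (y ++ b :: x) t)) ^ 2 ≤
        116 * 2 ^ k * q * cylSum e (p + 1 + k) t := by
    refine (hq _ (fun y => 116 * 2 ^ k * wordSum Finset.univ k fun z =>
      e (appRay (y ++ b :: z) t)) (fun y => mul_nonneg (by positivity)
        (wordSum_nonneg _ _ fun z => he.nonneg _)) fun y _ hy => ?_).trans ?_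
    · have hl := he.lineBound hb (y := y) (by omega) t
      rcases hx with rfl | rfl
      · refine (hl.sq_mean_sub_le hb.symm k).trans ?_
        have := wordSum_nonneg Finset.univ k hl.nonneg
        gcongr
        norm_num
      · exact hl.sq_mean_sub_lineEnd_le hb.symm k
    · rw [wordSum_mul_left, map_wordSum, cylSum_add_length]
      have h4 : (wordSum Finset.univ k fun z => wordSum Finset.univ p fun y =>
          e (appRay (y ++ b :: z) t)) ≤
            wordSum Finset.univ k fun z => cylSum e (p + 1) (appRay z t) := by
        refine wordSum_mono _ _ fun z _ => ?_
        simpa [cylSum] using cylSum_consRay_le he.nonneg p b (appRay z t)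
      calc _ ≤ q * (116 * 2 ^ k * wordSum Finset.univ k fun z =>
            cylSum e (p + 1) (appRay z t)) := by gcongr
        _ = _ := by ring
  have h4 : (sparseMean b a p fun y => (wordMean Finset.univ k fun z =>
      f (appRay (y ++ b :: z) t)) - f (appRay (y ++ b :: x) t)) =
      (wordMean Finset.univ k fun z => sparseMean b a p fun y => f (appRay (y ++ b :: z) t)) -
        sparseMean b a p fun y => f (appRay (y ++ b :: x) t) := by
    -- The average over blocks is taken outside the sparse mean, so that the three differences
    -- telescope.
    rw [← map_wordMean]
    exact map_sub (sparseMean b a p) _ _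
  rw [wordMean_sub] at h1 h2
  rw [h4] at h3
  rw [← cylMean_add_length] at h1
  have h5 := sq_add_three_le _ _ _ |>.trans
    (mul_le_mul_of_nonneg_left (add_le_add (add_le_add h1 h2) h3) (by norm_num : (0 : ℝ) ≤ 3))
  refine le_trans (le_of_eq ?_) (h5.trans (le_of_eq ?_))
  · congr 1
    ring
  · ring

/-- Both cylinders are brought to sparse words with the same prefix and block, and these are joined
by single moves. To cross, the block is the end of the line, whose final b frees the letter at n.
For the ladder, the block is zero and the move changes the 0 behind the b at n to b; the cylinder so
reached is part of the target, and one crossing completes the step. -/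
theorem cross_and_ladder_of_spread {d m : ℕ} [NeZero m] {b : Fin m} (hb : b ≠ 0) {a p : ℕ}
    (had : a + 1 ≤ d) {R s q : ℝ} (hR : CrossBound d m p R) (hs : SpreadBound d b a p s)
    (hR0 : 0 ≤ R) (hs0 : 0 ≤ s) (hq0 : 0 ≤ q) (hq : SparseMassBound b a p q) (k : ℕ) :
    CrossBound d m (p + 1 + k) (120 * ((R + s) / m ^ k + 116 * 2 ^ k * q)) ∧
      LadderBound d b (p + 1 + k) (120 * ((R + s) / m ^ k + 116 * 2 ^ k * q)) := by
  set D := 3 * ((R + s) / m ^ k + 116 * 2 ^ k * q) with hD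
  have hqD : q ≤ D := by
    have h1 : 0 ≤ (R + s) / (m : ℝ) ^ k := by positivity
    have h2 : 1 * q ≤ 2 ^ k * q := by gcongr; exact one_le_pow₀ one_le_two
    nlinarith
  have hD0 : 0 ≤ D := hq0.trans hqD
  have key {f e : Ray m → ℝ} (he : EdgeBound d f e) (t : Ray m) {x : List (Fin m)}
      (hx : x = List.replicate k 0 ∨ x = lineEnd 0 b k) :=
    sq_sub_sparseMean_le hb had hR hs hs0 hq0 hq he t hx
  have move {f e : Ray m → ℝ} (he : EdgeBound d f e) (t t' : Ray m) {x : List (Fin m)}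
      (hx : x.length = k) (h : ∀ y, numNonzero y ≤ a →
        (f (appRay (y ++ b :: x) t) - f (appRay (y ++ b :: x) t')) ^ 2 ≤
          e (appRay (y ++ b :: x) t)) :
      ((sparseMean b a p fun y => f (appRay (y ++ b :: x) t)) -
        sparseMean b a p fun y => f (appRay (y ++ b :: x) t')) ^ 2 ≤
          D * cylSum e (p + 1 + k) t := by
    have h1 := hq (fun y => f (appRay (y ++ b :: x) t) - f (appRay (y ++ b :: x) t'))
      (fun y => e (appRay (y ++ b :: x) t)) (fun y => he.nonneg _) fun y _ => h y
    have h2 := wordSum_append_le p (b :: x) (ψ := fun y => e (appRay y t)) fun y => he.nonneg _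
    rw [List.length_cons, hx, add_comm k 1, ← add_assoc] at h2
    have h3 : q * (wordSum Finset.univ p fun y => e (appRay (y ++ b :: x) t)) ≤
        D * cylSum e (p + 1 + k) t :=
      mul_le_mul hqD h2 (wordSum_nonneg _ _ fun y => he.nonneg _) hD0
    exact le_trans (le_of_eq (congrArg (· ^ 2) (map_sub (sparseMean b a p) _ _).symm))
      (h1.trans h3)
  -- The factor 9 comes from three stages of resistance D each, with the factor 3 from
  -- `sq_add_three_le`.
  have cross : CrossBound d m (p + 1 + k) (9 * D) := by
    intro f e he t c c'
    have h1 := key he (consRay c t) (Or.inr rfl)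
    have h2 := key he (consRay c' t) (Or.inr rfl)
    have h3 := move he (consRay c t) (consRay c' t) (length_lineEnd 0 b k) fun y hy => by
      obtain ⟨u, hu, hu'⟩ := exists_cons_lineEnd_eq b k
      have := he.next (y ++ u) b c c' t (by rw [numNonzero_append]; omega) hb
      rw [hu]
      simpa using this
    have h4 := mul_le_mul_of_nonneg_left
      (cylSum_consRay_le he.nonneg (p + 1 + k) c t) hD0
    have h5 := mul_le_mul_of_nonneg_left
      (cylSum_consRay_le he.nonneg (p + 1 + k) c' t) hD0
    rw [← hD] at h1 h2
    have h6 := sq_add_three_le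
      (cylMean f (p + 1 + k) (consRay c t) -
        sparseMean b a p fun y => f (appRay (y ++ b :: lineEnd 0 b k) (consRay c t)))
      ((sparseMean b a p fun y => f (appRay (y ++ b :: lineEnd 0 b k) (consRay c t))) -
        sparseMean b a p fun y => f (appRay (y ++ b :: lineEnd 0 b k) (consRay c' t)))
      (-(cylMean f (p + 1 + k) (consRay c' t) -
        sparseMean b a p fun y => f (appRay (y ++ b :: lineEnd 0 b k) (consRay c' t))))
    rw [neg_sq] at h6
    refine le_trans (le_of_eq ?_) (h6.trans ?_)
    · ring
    · linarith
  constructor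
  · intro f e he t c c'
    refine (cross f e he t c c').trans ?_
    have := cylSum_nonneg he.nonneg (p + 1 + k + 1) t
    nlinarith
  · intro f e he t
    set E₀ := cylSum e (p + 1 + k) (consRay b (consRay 0 t))
    set E₁ := cylSum e (p + 1 + k + 1) (consRay b t)
    have hE₀ : 0 ≤ E₀ := cylSum_nonneg he.nonneg _ _
    have hE₁ : 0 ≤ E₁ := cylSum_nonneg he.nonneg _ _
    have h1 := key he (consRay b (consRay 0 t)) (Or.inl rfl)
    have h2 := key he (consRay b (consRay b t)) (Or.inl rfl)
    have h3 := move he (consRay b (consRay 0 t)) (consRay b (consRay b t))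
      (List.length_replicate (n := k) (a := 0)) fun y hy => by
        have h4 := numNonzero_cons_le b (List.replicate k 0)
        rw [numNonzero_replicate_zero] at h4
        simpa using he.next (y ++ b :: List.replicate k 0) b 0 b t
          (by rw [numNonzero_append]; omega) hb
    have h4 := cross.sq_sub_le he b (consRay b t)
    have h5 := mul_le_mul_of_nonneg_left
      (cylSum_consRay_le he.nonneg (p + 1 + k) b (consRay b t)) hD0
    rw [← hD] at h1 h2
    generalize (sparseMean b a p fun y => f (appRay (y ++ b :: List.replicate k 0)
      (consRay b (consRay 0 t)))) = g₀ at *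
    generalize (sparseMean b a p fun y => f (appRay (y ++ b :: List.replicate k 0)
      (consRay b (consRay b t)))) = g₁ at *
    generalize cylMean f (p + 1 + k) (consRay b (consRay 0 t)) = x₀ at *
    generalize cylMean f (p + 1 + k) (consRay b (consRay b t)) = x₁ at *
    generalize cylMean f (p + 1 + k + 1) (consRay b t) = x₂ at *
    have h6 : (x₀ - x₂) ^ 2 ≤
        4 * ((x₀ - g₀) ^ 2 + (g₀ - g₁) ^ 2 + (x₁ - g₁) ^ 2 + (x₂ - x₁) ^ 2) := by
      nlinarith [sq_nonneg ((x₀ - g₀) - (g₀ - g₁)), sq_nonneg ((x₀ - g₀) + (x₁ - g₁)),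
        sq_nonneg ((x₀ - g₀) + (x₂ - x₁)), sq_nonneg ((g₀ - g₁) + (x₁ - g₁)),
        sq_nonneg ((g₀ - g₁) + (x₂ - x₁)), sq_nonneg ((x₁ - g₁) - (x₂ - x₁))]
    have h7 : 0 ≤ D * E₀ := mul_nonneg hD0 hE₀
    have h8 : D * cylSum e (p + 1 + k) (consRay b (consRay b t)) ≤ D * E₁ := h5
    -- Four stages give 4(D E₀ + D E₀ + D E₁ + 9 D E₁) ≤ 40 D (E₀ + E₁).
    have h9 : 120 * ((R + s) / m ^ k + 116 * 2 ^ k * q) = 40 * D := by rw [hD]; ring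
    rw [h9]
    linarith

/-! ### Climbing the ladder -/

/-- The series law on the ladder. Its cylinders are disjoint, and each one serves at most two steps,
whence the factor 2. -/
theorem sq_sub_le_of_ladder {d m : ℕ} [NeZero m] {b : Fin m} (hb : b ≠ 0) {T : ℕ → ℝ} {i p : ℕ}
    (hi : i ≤ p) (hT0 : ∀ j, 0 ≤ T j) (hT : ∀ j ∈ Finset.Ico i p, LadderBound d b j (T j))
    {f e : Ray m → ℝ} (he : EdgeBound d f e) (t : Ray m) :
    (cylMean f i (appRay (b :: List.replicate (p - i) 0) t) - cylMean f p (consRay b t)) ^ 2 ≤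
      2 * (∑ j ∈ Finset.Ico i p, T j) * cylSum e (p + 1) t := by
  set u := fun j => cylMean f j (appRay (b :: List.replicate (p - j) 0) t) with hu
  set V := fun j => cylSum e j (appRay (b :: List.replicate (p - j) 0) t) with hV
  have hV0 : ∀ j, 0 ≤ V j := fun j => cylSum_nonneg he.nonneg _ _
  have h1 : cylMean f i (appRay (b :: List.replicate (p - i) 0) t) - cylMean f p (consRay b t) =
      ∑ j ∈ Finset.Ico i p, (u j - u (j + 1)) := by
    have h := Finset.sum_Ico_consecutive (fun j => u j - u (j + 1)) (Nat.zero_le i) hi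
    simp only [Nat.Ico_zero_eq_range, Finset.sum_range_sub'] at h
    have h' : u p = cylMean f p (consRay b t) := by simp [hu]
    rw [← h']
    linarith
  have h2 : ∑ j ∈ Finset.range (p + 1), V j ≤ cylSum e (p + 1) t := by
    simpa [hV, cylSum] using sum_wordSum_append_replicate_le hb.symm p
      (ψ := fun y => e (appRay y t)) fun y => he.nonneg _
  have h3 : ∀ j ∈ Finset.Ico i p, (u j - u (j + 1)) ^ 2 ≤ T j * (V j + V (j + 1)) := by
    intro j hj
    have hj' := (Finset.mem_Ico.1 hj).2
    have h4 := hT j hj f e he (appRay (List.replicate (p - (j + 1)) 0) t)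
    rw [← appRay_cons 0, ← List.replicate_succ, ← appRay_cons b, ← appRay_cons b,
      show p - (j + 1) + 1 = p - j by omega] at h4
    exact h4
  have h4 := Finset.sum_sq_le_sum_mul_sum_of_sq_le_mul (Finset.Ico i p)
    (r := fun j => u j - u (j + 1)) (f := T) (g := fun j => V j + V (j + 1))
    (fun j _ => hT0 j) (fun j _ => add_nonneg (hV0 j) (hV0 (j + 1))) h3
  have h5 : ∑ j ∈ Finset.Ico i p, V j ≤ ∑ j ∈ Finset.range (p + 1), V j :=
    Finset.sum_le_sum_of_subset_of_nonneg (fun j hj => by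
      rw [Finset.mem_Ico] at hj; rw [Finset.mem_range]; omega) fun j _ _ => hV0 j
  have h6 : ∑ j ∈ Finset.Ico i p, V (j + 1) ≤ ∑ j ∈ Finset.range (p + 1), V j := by
    rw [Finset.sum_Ico_add' V i p 1]
    exact Finset.sum_le_sum_of_subset_of_nonneg (fun j hj => by
      rw [Finset.mem_Ico] at hj; rw [Finset.mem_range]; omega) fun j _ _ => hV0 j
  rw [h1]
  refine h4.trans ?_
  have h7 : 0 ≤ ∑ j ∈ Finset.Ico i p, T j := Finset.sum_nonneg fun j _ => hT0 j
  rw [Finset.sum_add_distrib]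
  nlinarith

theorem spreadBound_length_zero (d : ℕ) {m : ℕ} [NeZero m] (b : Fin m) (a : ℕ) :
    SpreadBound d b a 0 0 := by
  intro f e _ t
  simp [sparseMean_length_zero, cylMean_zero]

/-- The route to the zero word: cross to last letter b, descend the ladder to b0⋯0, change the first
letter. -/
theorem spreadBound_zero_succ {d m : ℕ} [NeZero m] {b : Fin m} (hb : b ≠ 0) {T : ℕ → ℝ} {p : ℕ}
    (hT0 : ∀ j, 0 ≤ T j) (hc : CrossBound d m p (T p))
    (hT : ∀ j < p, LadderBound d b j (T j)) :
    SpreadBound d b 0 (p + 1) (6 * ∑ j ∈ Finset.range (p + 1), T j + 3) := by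
  intro f e he t
  have h1 := hc.sq_sub_le he b t
  have h2 := sq_sub_le_of_ladder hb p.zero_le hT0 (fun j hj => hT j (Finset.mem_Ico.1 hj).2) he t
  have h3 := he.head b 0 (appRay (List.replicate p 0) t)
  have h4 := single_le_wordSum (A := Finset.univ) (y := b :: List.replicate p 0)
    (φ := fun y => e (appRay y t)) (by simp) fun y => he.nonneg _
  rw [List.length_cons, List.length_replicate, appRay_cons] at h4
  have h5 : e (consRay b (appRay (List.replicate p 0) t)) ≤ cylSum e (p + 1) t := h4
  have hE := cylSum_nonneg he.nonneg (p + 1) t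
  have h6 := mul_nonneg (hT0 p) hE
  rw [sparseMean_zero, List.replicate_succ, appRay_cons]
  rw [cylMean_zero, Nat.sub_zero, appRay_cons, Nat.Ico_zero_eq_range] at h2
  have h7 := sq_add_three_le (cylMean f (p + 1) t - cylMean f p (consRay b t))
    (-(f (consRay b (appRay (List.replicate p 0) t)) - cylMean f p (consRay b t)))
    (f (consRay b (appRay (List.replicate p 0) t)) - f (consRay 0 (appRay (List.replicate p 0) t)))
  rw [neg_sq] at h7
  rw [Finset.sum_range_succ]
  refine le_trans (le_of_eq ?_) (h7.trans ?_)
  · ring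
  · linarith

/-- Cross to last letter b, descend the ladder to a random rung of the second half, and spread
inside that cylinder. The final spreads run in parallel in disjoint cylinders, so s is divided by
the number of rungs, and the ladder is used only over its upper half. -/
theorem spreadBound_succ_succ {d m : ℕ} [NeZero m] {b : Fin m} (hb : b ≠ 0) {T : ℕ → ℝ} {a p : ℕ}
    {s : ℝ} (hs0 : 0 ≤ s) (hT0 : ∀ j, 0 ≤ T j) (hc : CrossBound d m p (T p))
    (hT : ∀ j < p, LadderBound d b j (T j))
    (hs : ∀ i ∈ Finset.Ico ((p + 1) / 2) (p + 1), SpreadBound d b a i s) :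
    SpreadBound d b (a + 1) (p + 1) (6 * ∑ j ∈ Finset.Ico ((p + 1) / 2) (p + 1), T j +
      3 * (s / (Finset.Ico ((p + 1) / 2) (p + 1)).card)) := by
  intro f e he t
  set I := Finset.Ico ((p + 1) / 2) (p + 1) with hI
  have hIne : I.Nonempty := nonempty_Ico_half p
  have hIpos : (0 : ℝ) < I.card := by exact_mod_cast hIne.card_pos
  have hE := cylSum_nonneg he.nonneg (p + 1) t
  set S := ∑ j ∈ Finset.Ico ((p + 1) / 2) p, T j
  have hIS : ∑ j ∈ I, T j = S + T p := Finset.sum_Ico_succ_top (by omega) T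
  set u := fun i => cylMean f i (appRay (b :: List.replicate (p - i) 0) t) with hu
  set g := fun i => sparseMean b a i fun y => f (appRay (y ++ b :: List.replicate (p - i) 0) t)
    with hg
  have h1 := hc.sq_sub_le he b t
  have h2 := sq_sum_div_card_le hIne (x := fun i => cylMean f p (consRay b t) - u i)
    (y := fun _ => 2 * S * cylSum e (p + 1) t) fun i hi => by
      rw [hI, Finset.mem_Ico] at hi
      have h3 := sq_sub_le_of_ladder hb (i := i) (p := p) (by omega) hT0
        (fun j hj => hT j (Finset.mem_Ico.1 hj).2) he t
      have h4 : ∑ j ∈ Finset.Ico i p, T j ≤ S := Finset.sum_le_sum_of_subset_of_nonneg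
        (Finset.Ico_subset_Ico_left hi.1) fun j _ _ => hT0 j
      rw [← neg_sub, neg_sq]
      refine h3.trans ?_
      gcongr
  have h3 := sq_sum_div_card_le hIne (x := fun i => u i - g i)
    (y := fun i => s * wordSum Finset.univ i fun y =>
      e (appRay (y ++ b :: List.replicate (p - i) 0) t)) fun i hi => by
      simpa [cylSum, hu, hg] using
        hs i hi f e he (appRay (b :: List.replicate (p - i) 0) t)
  have h4 := sum_wordSum_Ico_half_le hb p (ψ := fun y => e (appRay y t)) fun y => he.nonneg _
  have h5 : (∑ i ∈ I, s * wordSum Finset.univ i fun y =>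
      e (appRay (y ++ b :: List.replicate (p - i) 0) t)) / I.card ≤
        s / I.card * cylSum e (p + 1) t := by
    rw [← Finset.mul_sum, div_mul_eq_mul_div]
    gcongr
    exact h4
  rw [Finset.sum_sub_distrib, sub_div, Finset.sum_const, nsmul_eq_mul, Finset.sum_const,
    nsmul_eq_mul, mul_div_cancel_left₀ _ hIpos.ne', mul_div_cancel_left₀ _ hIpos.ne'] at h2
  rw [Finset.sum_sub_distrib, sub_div] at h3
  have h6 := sq_add_three_le _ _ _ |>.trans (mul_le_mul_of_nonneg_left
    (add_le_add (add_le_add h1 h2) (h3.trans h5)) (by norm_num : (0 : ℝ) ≤ 3))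
  rw [sparseMean_succ_succ, hIS]
  have h7 := mul_nonneg (hT0 p) hE
  refine le_trans (le_of_eq ?_) (h6.trans ?_)
  · congr 1
    ring
  · linarith

/-! ### Polynomial decay of the resistances -/

/-- `T` bounds the resistances in `CrossBound` and `LadderBound`. -/
def ScaleBound (d : ℕ) {m : ℕ} [NeZero m] (b : Fin m) (n : ℕ) (T : ℝ) : Prop :=
  CrossBound d m n T ∧ LadderBound d b n T

theorem ScaleBound.mono {d m : ℕ} [NeZero m] {b : Fin m} {n : ℕ} {T T' : ℝ}
    (h : ScaleBound d b n T) (hT : T ≤ T') : ScaleBound d b n T' :=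
  ⟨fun f e he t c c' => (h.1 f e he t c c').trans
    (mul_le_mul_of_nonneg_right hT (cylSum_nonneg he.nonneg _ _)),
  fun f e he t => (h.2 f e he t).trans (mul_le_mul_of_nonneg_right hT
    (add_nonneg (cylSum_nonneg he.nonneg _ _) (cylSum_nonneg he.nonneg _ _)))⟩

theorem crossBound_zero (d m : ℕ) [NeZero m] : CrossBound d m 0 1 := by
  intro f e he t c c'
  have h := wordSum_append_singleton_le (A := Finset.univ) 0 (Finset.mem_univ c)
    (φ := fun y => e (appRay y t)) fun y => he.nonneg _
  rw [one_mul, cylMean_zero, cylMean_zero]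
  exact (he.head c c' t).trans h

theorem scaleBound_zero (d : ℕ) {m : ℕ} [NeZero m] {b : Fin m} (hb : b ≠ 0) :
    ScaleBound d b 0 2 := by
  constructor
  · intro f e he t c c'
    refine (crossBound_zero d m f e he t c c').trans ?_
    have := cylSum_nonneg he.nonneg (0 + 1) t
    linarith
  · intro f e he t
    have h1 := (crossBound_zero d m).sq_sub_le he b (consRay b t)
    have h2 := he.next [] b 0 b t (by simp [numNonzero]) hb
    simp only [appRay_nil] at h2
    simp only [cylMean_zero] at h1 ⊢
    have h3 : cylSum e 0 (consRay b (consRay 0 t)) = e (consRay b (consRay 0 t)) := rfl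
    rw [h3]
    nlinarith [sq_nonneg ((f (consRay b (consRay 0 t)) - f (consRay b (consRay b t))) +
      (cylMean f (0 + 1) (consRay b t) - f (consRay b (consRay b t))))]

/-- Crossing along a single line, with empty prefix p = 0. The bound grows with n and only starts
the induction. -/
theorem scaleBound_two_pow {d m : ℕ} [NeZero m] {b : Fin m} (hb : b ≠ 0) (hd : 1 ≤ d) (n : ℕ) :
    ScaleBound d b n (14040 * 2 ^ n) := by
  cases n with
  | zero => exact (scaleBound_zero d hb).mono (by norm_num)
  | succ k =>
    have h := cross_and_ladder_of_spread (d := d) hb (a := 0) (p := 0) hd (crossBound_zero d m)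
      (spreadBound_length_zero d b 0) zero_le_one le_rfl zero_le_one (sparseMassBound_zero b 0) k
    rw [show 0 + 1 + k = k + 1 by ring] at h
    refine ScaleBound.mono h ?_
    have h1 : (1 + 0) / (m : ℝ) ^ k ≤ 1 := by
      rw [add_zero]
      refine div_le_one_of_le₀ (one_le_pow₀ ?_) (by positivity)
      exact_mod_cast NeZero.one_le
    have h2 : (1 : ℝ) ≤ 2 ^ k := one_le_pow₀ one_le_two
    rw [pow_succ]
    linarith

theorem add_two_le_three_mul_card_Ico (p : ℕ) :
    ((p : ℝ) + 2) / 3 ≤ (Finset.Ico ((p + 1) / 2) (p + 1)).card := by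
  rw [div_le_iff₀ (by norm_num), Nat.card_Ico]
  have : p + 2 ≤ (p + 1 - (p + 1) / 2) * 3 := by omega
  exact_mod_cast this

theorem add_two_div_two_le_of_mem_Ico {p i : ℕ} (hi : i ∈ Finset.Ico ((p + 1) / 2) (p + 1)) :
    ((p : ℝ) + 2) / 2 ≤ i + 1 := by
  rw [Finset.mem_Ico] at hi
  have : p + 2 ≤ (i + 1) * 2 := by omega
  rw [div_le_iff₀ (by norm_num)]
  exact_mod_cast this

/-- Each new letter has at least a third of the length as possible places, and the remaining prefix
keeps about half of the length, so every letter contributes a factor of order 1/p. -/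
theorem exists_sparseMassBound {m : ℕ} [NeZero m] {b : Fin m} (hb : b ≠ 0) (a : ℕ) :
    ∃ Q : ℝ, 1 ≤ Q ∧ ∀ p : ℕ, SparseMassBound b a p (Q / ((p : ℝ) + 1) ^ a) := by
  induction a with
  | zero => exact ⟨1, le_rfl, fun p => by simpa using sparseMassBound_zero b p⟩
  | succ a ih =>
    obtain ⟨Q, hQ, h⟩ := ih
    have hQ0 : 0 ≤ Q := zero_le_one.trans hQ
    have h2 : (1 : ℝ) ≤ 2 ^ a := one_le_pow₀ one_le_two
    refine ⟨3 * 2 ^ a * Q, by nlinarith, fun p => ?_⟩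
    cases p with
    | zero => exact (sparseMassBound_length_zero b _).mono (by simp; nlinarith)
    | succ p =>
      have hp : (0 : ℝ) < (p : ℝ) + 2 := by positivity
      refine (SparseMassBound.succ hb (a := a) (p := p) (q := Q / (((p : ℝ) + 2) / 2) ^ a)
        (by positivity) fun i hi => (h i).mono ?_).mono ?_
      · have := add_two_div_two_le_of_mem_Ico hi
        gcongr
      · have := add_two_le_three_mul_card_Ico p
        calc Q / (((p : ℝ) + 2) / 2) ^ a / (Finset.Ico ((p + 1) / 2) (p + 1)).card
            ≤ Q / (((p : ℝ) + 2) / 2) ^ a / (((p : ℝ) + 2) / 3) := by gcongr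
          _ = 3 * 2 ^ a * Q / (((p + 1 : ℕ) : ℝ) + 1) ^ (a + 1) := by
            push_cast
            rw [show (p : ℝ) + 1 + 1 = p + 2 by ring, div_pow, pow_succ]
            field_simp

theorem rpow_neg_le_of_half_le {x y r : ℝ} (hx : 0 < x) (hr : 0 ≤ r) {l : ℕ} (hl : r ≤ l)
    (h : x / 2 ≤ y) : y ^ (-r) ≤ 2 ^ l * x ^ (-r) := by
  have h1 : y ^ (-r) ≤ (x / 2) ^ (-r) :=
    Real.rpow_le_rpow_of_nonpos (by positivity) h (by linarith)
  refine h1.trans ?_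
  rw [Real.div_rpow hx.le zero_le_two, div_eq_inv_mul, ← Real.rpow_neg zero_le_two, neg_neg]
  gcongr
  rw [← Real.rpow_natCast]
  exact Real.rpow_le_rpow_of_exponent_le one_le_two hl

theorem exists_sum_rpow_le : ∃ W : ℝ, 0 ≤ W ∧
    ∀ n, ∑ j ∈ Finset.range n, ((j : ℝ) + 1) ^ (-(4 / 3) : ℝ) ≤ W := by
  have h : Summable fun j : ℕ => ((j : ℝ) + 1) ^ (-(4 / 3) : ℝ) := by
    have h1 := (summable_nat_add_iff 1).2
      (Real.summable_nat_rpow (p := (-(4 / 3) : ℝ)) |>.2 (by norm_num))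
    simpa using h1
  have h0 : ∀ j : ℕ, (0 : ℝ) ≤ ((j : ℝ) + 1) ^ (-(4 / 3) : ℝ) := fun j => by positivity
  exact ⟨_, tsum_nonneg h0, fun n => h.sum_le_tsum _ fun j _ => h0 j⟩

theorem rpow_four_thirds_mul {x : ℝ} (hx : 0 < x) :
    x * x ^ (-(4 / 3) : ℝ) = x ^ (-(1 / 3) : ℝ) := by
  nth_rewrite 1 [← Real.rpow_one x]
  rw [← Real.rpow_add hx]
  norm_num

/-- The upper half of the ladder has at most about p terms of size B p^(-4/3), and the remaining
spread S B is divided by about p. Both are at most of order B p^(-1/3). -/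
theorem spreadBound_succ_of_scaleBound {d m : ℕ} [NeZero m] {b : Fin m} (hb : b ≠ 0) {a p : ℕ}
    {S B : ℝ} (hS : 0 ≤ S) (hB : 0 ≤ B)
    (h : ∀ j < p, ScaleBound d b j (B * ((j : ℝ) + 1) ^ (-(4 / 3) : ℝ)))
    (hs : ∀ i < p, SpreadBound d b a i (S * B)) :
    SpreadBound d b (a + 1) p ((24 + 9 * S) * B * ((p : ℝ) + 1) ^ (-(1 / 3) : ℝ)) := by
  cases p with
  | zero => exact (spreadBound_length_zero d b _).mono (by positivity)
  | succ p =>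
    refine (spreadBound_succ_succ hb (s := S * B)
      (T := fun j => B * ((j : ℝ) + 1) ^ (-(4 / 3) : ℝ)) (by positivity) (fun j => by positivity)
      (h p (by omega)).1 (fun j hj => (h j (by omega)).2)
      fun i hi => hs i (Finset.mem_Ico.1 hi).2).mono ?_
    have hp : (0 : ℝ) < (p : ℝ) + 2 := by positivity
    push_cast
    rw [show (p : ℝ) + 1 + 1 = p + 2 by ring]
    have h1 : ∑ j ∈ Finset.Ico ((p + 1) / 2) (p + 1), B * ((j : ℝ) + 1) ^ (-(4 / 3) : ℝ) ≤
        4 * B * ((p : ℝ) + 2) ^ (-(1 / 3) : ℝ) := by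
      calc _ ≤ ∑ j ∈ Finset.Ico ((p + 1) / 2) (p + 1),
            B * (2 ^ 2 * ((p : ℝ) + 2) ^ (-(4 / 3) : ℝ)) := by
            refine Finset.sum_le_sum fun j hj => ?_
            gcongr
            exact rpow_neg_le_of_half_le hp (by norm_num) (by norm_num)
              (add_two_div_two_le_of_mem_Ico hj)
        _ ≤ ((p : ℝ) + 2) * (B * (2 ^ 2 * ((p : ℝ) + 2) ^ (-(4 / 3) : ℝ))) := by
            rw [Finset.sum_const, nsmul_eq_mul]
            gcongr
            rw [Nat.card_Ico]
            have : p + 1 - (p + 1) / 2 ≤ p + 2 := by omega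
            exact_mod_cast this
        _ = _ := by rw [← rpow_four_thirds_mul hp]; ring
    have h2 : S * B / (Finset.Ico ((p + 1) / 2) (p + 1)).card ≤
        3 * S * B * ((p : ℝ) + 2) ^ (-(1 / 3) : ℝ) := by
      calc _ ≤ S * B / (((p : ℝ) + 2) / 3) := by
            have := add_two_le_three_mul_card_Ico p
            gcongr
        _ = 3 * S * B * ((p : ℝ) + 2) ^ (-1 : ℝ) := by
            rw [Real.rpow_neg_one]
            field_simp
        _ ≤ _ := by
            gcongr
            · linarith [(Nat.cast_nonneg p : (0 : ℝ) ≤ p)]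
            · norm_num
    linarith

/-- What matters is that S does not depend on B or p: the choice of M in the induction precedes that
of B. -/
theorem exists_spreadBound_of_scaleBound (d : ℕ) {m : ℕ} [NeZero m] {b : Fin m} (hb : b ≠ 0)
    (a : ℕ) : ∃ S : ℝ, 0 ≤ S ∧ ∀ B : ℝ, 1 ≤ B → ∀ p : ℕ,
      (∀ j < p, ScaleBound d b j (B * ((j : ℝ) + 1) ^ (-(4 / 3) : ℝ))) →
        SpreadBound d b a p (S * B) := by
  induction a with
  | zero =>
    obtain ⟨W, hW, hsum⟩ := exists_sum_rpow_le
    refine ⟨6 * W + 3, by positivity, fun B hB p h => ?_⟩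
    cases p with
    | zero => exact (spreadBound_length_zero d b _).mono (by positivity)
    | succ p =>
      refine (spreadBound_zero_succ hb (T := fun j => B * ((j : ℝ) + 1) ^ (-(4 / 3) : ℝ))
        (fun j => by positivity) (h p (by omega)).1 fun j hj => (h j (by omega)).2).mono ?_
      rw [← Finset.mul_sum]
      have := mul_le_mul_of_nonneg_left (hsum (p + 1)) (zero_le_one.trans hB)
      linarith
  | succ a ih =>
    obtain ⟨S, hS, ih⟩ := ih
    refine ⟨24 + 9 * S, by positivity, fun B hB p h => ?_⟩
    refine (spreadBound_succ_of_scaleBound hb hS (zero_le_one.trans hB) h fun i hi =>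
      ih B hB i fun j hj => h j (hj.trans hi)).mono ?_
    refine mul_le_of_le_one_right (by positivity) ?_
    refine Real.rpow_le_one_of_one_le_of_nonpos ?_ (by norm_num)
    linarith [(Nat.cast_nonneg p : (0 : ℝ) ≤ p)]

theorem sq_le_two_pow {l : ℕ} (hl : 4 ≤ l) : l ^ 2 ≤ 2 ^ l := by
  induction l, hl using Nat.le_induction with
  | base => norm_num
  | succ l hl ih => rw [pow_succ 2 l]; nlinarith

/-- For n large compared with M, the logarithm of M(n + 1) is below n/2, so the block takes less
than half of the n letters. -/
theorem exists_pow_between {m M n : ℕ} (hm : 2 ≤ m) (hM : 1 ≤ M) (hn : 10 * M + 12 ≤ n) :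
    ∃ k, 2 * k + 1 ≤ n ∧ M * (n + 1) ≤ m ^ k ∧ m ^ k ≤ m * M * (n + 1) := by
  have h1 : 1 < M * (n + 1) := by nlinarith
  refine ⟨Nat.clog m (M * (n + 1)), ?_, Nat.le_pow_clog hm _, ?_⟩
  · have h2 : Nat.clog m (M * (n + 1)) ≤ (n - 1) / 2 := by
      refine Nat.clog_le_of_le_pow ?_
      set l := (n - 1) / 2 with hl
      have h3 : 5 * M ≤ l := by omega
      have h4 : n + 1 ≤ 2 * l + 3 := by omega
      calc M * (n + 1) ≤ M * (2 * l + 3) := by gcongr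
        _ ≤ l ^ 2 := by nlinarith
        _ ≤ 2 ^ l := sq_le_two_pow (by omega)
        _ ≤ m ^ l := by gcongr
    omega
  · have h2 := Nat.pow_pred_clog_lt_self hm h1
    have h3 := Nat.clog_pos hm h1
    obtain ⟨k, hk⟩ : ∃ k, Nat.clog m (M * (n + 1)) = k + 1 := ⟨_, (Nat.succ_pred_eq_of_pos h3).symm⟩
    rw [hk] at h2 ⊢
    rw [Nat.pred_succ] at h2
    rw [pow_succ', mul_assoc]
    gcongr

theorem exists_scaleBound {d m : ℕ} [NeZero m] (hm : 2 ≤ m) {b : Fin m} (hb : b ≠ 0) {a : ℕ}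
    (had : a + 2 ≤ d) (hgrowth : ∀ (k : ℕ) (x : ℝ), 1 ≤ x → (m : ℝ) ^ k ≤ x →
      2 ^ k / x ^ (a + 1) ≤ x ^ (-(4 / 3) : ℝ)) :
    ∃ B : ℝ, 0 ≤ B ∧ ∀ n : ℕ, ScaleBound d b n (B * ((n : ℝ) + 1) ^ (-(4 / 3) : ℝ)) := by
  obtain ⟨Q, hQ, hq⟩ := exists_sparseMassBound hb (a + 1)
  obtain ⟨S, hS, hs⟩ := exists_spreadBound_of_scaleBound d hb a
  set S' := 24 + 9 * S with hS'
  have hS'0 : 0 ≤ S' := by positivity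
  -- With this M the first term of the recursion, at most 120 (4 + 2S')/M times B, accounts for at
  -- most half of B.
  obtain ⟨M, hM⟩ := exists_nat_ge (240 * (4 + 2 * S'))
  have hM1 : 1 ≤ M := by
    have : (1 : ℝ) ≤ M := by linarith
    exact_mod_cast this
  have hMpos : (0 : ℝ) < M := by exact_mod_cast hM1
  have hmpos : (0 : ℝ) < m := by exact_mod_cast NeZero.pos m
  set n₀ := 10 * M + 12 with hn₀
  -- The second term of the recursion is at most C times the power of n, with 13920 = 120 · 116. In
  -- B below, 2C makes this the other half, and the last summand covers n < n₀.
  set C := 13920 * (Q * 2 ^ (a + 1) * (m * M) ^ (a + 1)) with hC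
  have hC0 : 0 ≤ C := by positivity
  have hw₀ : (0 : ℝ) < ((n₀ : ℝ) + 1) ^ (-(4 / 3) : ℝ) := by positivity
  set B := 1 + 2 * C + 14040 * 2 ^ n₀ / ((n₀ : ℝ) + 1) ^ (-(4 / 3) : ℝ) with hBdef
  have hBbase : 14040 * 2 ^ n₀ / ((n₀ : ℝ) + 1) ^ (-(4 / 3) : ℝ) ≤ B := by linarith
  have hB1 : 1 ≤ B := by
    have : 0 ≤ 14040 * 2 ^ n₀ / ((n₀ : ℝ) + 1) ^ (-(4 / 3) : ℝ) := by positivity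
    linarith
  have hB2 : 2 * C ≤ B := by
    have : 0 ≤ 14040 * 2 ^ n₀ / ((n₀ : ℝ) + 1) ^ (-(4 / 3) : ℝ) := by positivity
    linarith
  have hB0 : 0 ≤ B := zero_le_one.trans hB1
  refine ⟨B, hB0, fun n => ?_⟩
  induction n using Nat.strong_induction_on with
  | _ n ih =>
    rcases lt_or_ge n n₀ with hn | hn
    · refine (scaleBound_two_pow hb (by omega) n).mono ?_
      rw [div_le_iff₀ hw₀] at hBbase
      calc (14040 : ℝ) * 2 ^ n ≤ 14040 * 2 ^ n₀ := by gcongr; norm_num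
        _ ≤ _ := hBbase
        _ ≤ _ := by
          refine mul_le_mul_of_nonneg_left ?_ hB0
          refine Real.rpow_le_rpow_of_nonpos (by positivity) ?_ (by norm_num)
          gcongr
    · obtain ⟨k, hk, hk1, hk2⟩ := exists_pow_between hm hM1 hn
      obtain ⟨p, hp⟩ : ∃ p, n = p + 1 + k := ⟨n - 1 - k, by omega⟩
      have hpn : p < n := by omega
      have hx : (0 : ℝ) < (n : ℝ) + 1 := by positivity
      have hx1 : (1 : ℝ) ≤ (n : ℝ) + 1 := by linarith [(Nat.cast_nonneg n : (0 : ℝ) ≤ n)]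
      have hhalf : ((n : ℝ) + 1) / 2 ≤ (p : ℝ) + 1 := by
        have : n + 1 ≤ (p + 1) * 2 := by omega
        rw [div_le_iff₀ (by norm_num)]
        exact_mod_cast this
      have hspread := spreadBound_succ_of_scaleBound hb hS hB0 (p := p)
        (fun j hj => ih j (hj.trans hpn)) fun i hi =>
          hs B hB1 i fun j hj => ih j (by omega)
      have h := cross_and_ladder_of_spread hb (by omega : a + 1 + 1 ≤ d) (ih p hpn).1 hspread
        (by positivity) (by positivity) (by positivity) (hq p) k
      rw [← hp] at h
      refine ScaleBound.mono h ?_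
      have hk1' : (M : ℝ) * (n + 1) ≤ m ^ k := by exact_mod_cast hk1
      have hk2' : (m : ℝ) ^ k ≤ m * M * (n + 1) := by exact_mod_cast hk2
      have hv : (0 : ℝ) < ((n : ℝ) + 1) ^ (-(1 / 3) : ℝ) := by positivity
      have hw : (0 : ℝ) < ((n : ℝ) + 1) ^ (-(4 / 3) : ℝ) := by positivity
      have h1 : (B * ((p : ℝ) + 1) ^ (-(4 / 3) : ℝ) +
          (24 + 9 * S) * B * ((p : ℝ) + 1) ^ (-(1 / 3) : ℝ)) / m ^ k ≤
            B * ((4 + 2 * S') / M) * ((n : ℝ) + 1) ^ (-(4 / 3) : ℝ) := by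
        have h2 : ((p : ℝ) + 1) ^ (-(4 / 3) : ℝ) ≤ 4 * ((n : ℝ) + 1) ^ (-(1 / 3) : ℝ) := by
          refine (rpow_neg_le_of_half_le (l := 2) hx (by norm_num) (by norm_num) hhalf).trans ?_
          rw [show (2 : ℝ) ^ 2 = 4 by norm_num]
          gcongr
          norm_num
        have h3 : ((p : ℝ) + 1) ^ (-(1 / 3) : ℝ) ≤ 2 * ((n : ℝ) + 1) ^ (-(1 / 3) : ℝ) := by
          simpa using rpow_neg_le_of_half_le (l := 1) hx (by norm_num) (by norm_num) hhalf
        calc _ ≤ (B * (4 * ((n : ℝ) + 1) ^ (-(1 / 3) : ℝ)) +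
              S' * B * (2 * ((n : ℝ) + 1) ^ (-(1 / 3) : ℝ))) / (M * (n + 1)) := by
                rw [← hS']
                gcongr
          _ = _ := by
                rw [← rpow_four_thirds_mul hx]
                field_simp
      have h2 : (4 + 2 * S') / M ≤ 1 / 240 := by
        rw [div_le_div_iff₀ hMpos (by norm_num)]
        linarith
      have h3 : 2 ^ k * (Q / ((p : ℝ) + 1) ^ (a + 1)) ≤
          Q * 2 ^ (a + 1) * (m * M) ^ (a + 1) * ((n : ℝ) + 1) ^ (-(4 / 3) : ℝ) := by
        have hmM : (1 : ℝ) ≤ m * M := by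
          have : 1 ≤ m * M := Nat.one_le_iff_ne_zero.2 (by positivity)
          exact_mod_cast this
        have h4 := hgrowth k (m * M * (n + 1)) (by nlinarith) hk2'
        have h5 : (m * M * ((n : ℝ) + 1)) ^ (-(4 / 3) : ℝ) ≤ ((n : ℝ) + 1) ^ (-(4 / 3) : ℝ) :=
          Real.rpow_le_rpow_of_nonpos hx (by nlinarith) (by norm_num)
        calc _ ≤ 2 ^ k * (Q / (((n : ℝ) + 1) / 2) ^ (a + 1)) := by gcongr
          _ = Q * 2 ^ (a + 1) * (m * M) ^ (a + 1) * (2 ^ k / (m * M * (n + 1)) ^ (a + 1)) := by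
            rw [div_pow, mul_pow _ ((n : ℝ) + 1)]
            field_simp
          _ ≤ _ := by
            gcongr
            exact h4.trans h5
      have h4 : B * ((4 + 2 * S') / M) * ((n : ℝ) + 1) ^ (-(4 / 3) : ℝ) ≤
          B * (1 / 240) * ((n : ℝ) + 1) ^ (-(4 / 3) : ℝ) := by gcongr
      have h5 : 2 * C * ((n : ℝ) + 1) ^ (-(4 / 3) : ℝ) ≤ B * ((n : ℝ) + 1) ^ (-(4 / 3) : ℝ) := by
        gcongr
      rw [hC] at h5
      linarith

theorem two_pow_div_cube_le (k : ℕ) {x : ℝ} (hx : 1 ≤ x) (h : ((2 : ℕ) : ℝ) ^ k ≤ x) :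
    2 ^ k / x ^ (2 + 1) ≤ x ^ (-(4 / 3) : ℝ) := by
  have hx0 : 0 < x := by linarith
  calc 2 ^ k / x ^ (2 + 1) ≤ x / x ^ (2 + 1) := by gcongr; exact_mod_cast h
    _ = x ^ (-2 : ℝ) := by
      rw [Real.rpow_neg hx0.le]
      norm_cast
      field_simp
    _ ≤ _ := Real.rpow_le_rpow_of_exponent_le hx (by norm_num)

/-- Since 2³ ≤ 3², 2^k ≤ x^(2/3). The exponent 4/3 = 2 - 2/3 used throughout comes from here. -/
theorem two_pow_div_sq_le {m : ℕ} (hm : 3 ≤ m) (k : ℕ) {x : ℝ} (hx : 1 ≤ x)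
    (h : (m : ℝ) ^ k ≤ x) : 2 ^ k / x ^ (1 + 1) ≤ x ^ (-(4 / 3) : ℝ) := by
  have hx0 : 0 < x := by linarith
  have hm' : (3 : ℝ) ≤ m := by exact_mod_cast hm
  have h1 : (2 : ℝ) ^ k ≤ x ^ (2 / 3 : ℝ) := by
    have h2 : ((2 : ℝ) ^ k) ^ 3 ≤ (x ^ (2 / 3 : ℝ)) ^ 3 := by
      calc ((2 : ℝ) ^ k) ^ 3 = 8 ^ k := by rw [← pow_mul, mul_comm, pow_mul]; norm_num
        _ ≤ 9 ^ k := by gcongr; norm_num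
        _ = (3 ^ k) ^ 2 := by rw [← pow_mul, mul_comm, pow_mul]; norm_num
        _ ≤ (m ^ k) ^ 2 := by gcongr
        _ ≤ x ^ 2 := by gcongr
        _ = (x ^ (2 / 3 : ℝ)) ^ 3 := by
          rw [← Real.rpow_natCast (x ^ (2 / 3 : ℝ)), ← Real.rpow_mul hx0.le]
          norm_num
    exact le_of_pow_le_pow_left₀ (by norm_num) (by positivity) h2
  calc 2 ^ k / x ^ (1 + 1) ≤ x ^ (2 / 3 : ℝ) / x ^ (1 + 1) := by gcongr
    _ = x ^ (-(4 / 3) : ℝ) := by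
      rw [← Real.rpow_natCast x, ← Real.rpow_sub hx0]
      norm_num

theorem exists_scaleBound_of_degree {d m : ℕ} [NeZero m] (h : (4 ≤ d ∧ 2 ≤ m) ∨ (3 ≤ d ∧ 3 ≤ m))
    {b : Fin m} (hb : b ≠ 0) :
    ∃ B : ℝ, 0 ≤ B ∧ ∀ n : ℕ, ScaleBound d b n (B * ((n : ℝ) + 1) ^ (-(4 / 3) : ℝ)) := by
  by_cases hm : 3 ≤ m
  · exact exists_scaleBound (by omega) hb (a := 1) (by omega) fun k x => two_pow_div_sq_le hm k
  · obtain rfl : m = 2 := by omega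
    exact exists_scaleBound le_rfl hb (a := 2) (by omega) fun k x => two_pow_div_cube_le k

/-! ### The resistance to infinity -/

theorem eq_consRay_iff {m : ℕ} (x t : Ray m) (c : Fin m) :
    x = consRay c t ↔ x 0 = c ∧ (fun i => x (i + 1)) = t := by
  constructor
  · rintro rfl
    exact ⟨rfl, rfl⟩
  · rintro ⟨rfl, rfl⟩
    funext i
    cases i <;> rfl

theorem cylSum_succ {m : ℕ} (e : Ray m → ℝ) (n : ℕ) (t : Ray m) :
    cylSum e (n + 1) t = ∑ c, cylSum e n (consRay c t) := by
  simp [cylSum, wordSum_succ]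

open Classical in
-- Different words in front of t give different rays, so the sum over a cylinder is part of the
-- total sum.
theorem cylSum_le_sum_filter {m : ℕ} {e : Ray m → ℝ} (he : ∀ x, 0 ≤ e x) {S : Finset (Ray m)}
    (hS : ∀ x ∉ S, e x = 0) (n : ℕ) (t : Ray m) :
    cylSum e n t ≤ ∑ x ∈ S with (fun i => x (n + i)) = t, e x := by
  induction n generalizing t with
  | zero =>
    have h0 : cylSum e 0 t = e t := rfl
    rw [h0]
    by_cases ht : t ∈ S
    · exact Finset.single_le_sum (fun x _ => he x) (by simp [ht])
    · rw [hS t ht]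
      exact Finset.sum_nonneg fun x _ => he x
  | succ n ih =>
    rw [cylSum_succ]
    refine (Finset.sum_le_sum fun c _ => ih (consRay c t)).trans (le_of_eq ?_)
    rw [← Finset.sum_fiberwise _ fun x : Ray m => x n]
    refine Finset.sum_congr rfl fun c _ => ?_
    rw [Finset.filter_filter]
    refine Finset.sum_congr (Finset.filter_congr fun x _ => ?_) fun _ _ => rfl
    have h : ∀ i, n + 1 + i = n + (i + 1) := fun i => by omega
    rw [eq_consRay_iff, and_comm]
    simp only [add_zero, h]

theorem cylSum_le_sum {m : ℕ} {e : Ray m → ℝ} (he : ∀ x, 0 ≤ e x) {S : Finset (Ray m)}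
    (hS : ∀ x ∉ S, e x = 0) (n : ℕ) (t : Ray m) : cylSum e n t ≤ ∑ x ∈ S, e x := by
  classical
  exact (cylSum_le_sum_filter he hS n t).trans
    (Finset.sum_le_sum_of_subset_of_nonneg (Finset.filter_subset _ _) fun x _ _ => he x)

theorem cylSum_le_finsum {m : ℕ} {e : Ray m → ℝ} (he : ∀ x, 0 ≤ e x)
    (hS : (Function.support e).Finite) (n : ℕ) (t : Ray m) : cylSum e n t ≤ ∑ᶠ x, e x := by
  rw [finsum_eq_sum e hS]
  exact cylSum_le_sum he (fun x hx => by simpa using hx) n t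

theorem abs_cylMean_le {m : ℕ} {f : Ray m → ℝ} (hf : (Function.support f).Finite) (n : ℕ)
    (t : Ray m) : |cylMean f n t| ≤ (∑ᶠ x, |f x|) / m ^ n := by
  have h1 := cylSum_le_finsum (e := fun x => |f x|) (fun x => abs_nonneg _)
    (by simpa [Function.support] using hf) n t
  have h2 : |wordSum Finset.univ n fun y => f (appRay y t)| ≤ cylSum (fun x => |f x|) n t := by
    refine abs_le.2 ⟨?_, wordSum_mono _ _ fun y _ => le_abs_self _⟩
    rw [neg_le, ← map_neg]
    exact wordSum_mono _ _ fun y _ => neg_le_abs _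
  rw [cylMean, wordMean, abs_div, Finset.card_univ, Fintype.card_fin,
    abs_of_nonneg (by positivity : (0 : ℝ) ≤ (m : ℝ) ^ n)]
  gcongr
  exact h2.trans h1

theorem appRay_replicate_zeroRay {m : ℕ} [NeZero m] (n : ℕ) :
    appRay (List.replicate n 0) (zeroRay m) = zeroRay m := by
  induction n with
  | zero => rfl
  | succ n ih =>
    rw [List.replicate_succ, appRay_cons, ih]
    exact ((eq_consRay_iff (zeroRay m) (zeroRay m) 0).2 ⟨rfl, rfl⟩).symm

/-- The ladder is climbed from b000⋯ without end. The mean over n free letters of a finitely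
supported f is O(m^(-n)), so the bound on differences becomes one on f itself. -/
theorem exists_sq_apply_zeroRay_le {d m : ℕ} [NeZero m]
    (h : (4 ≤ d ∧ 2 ≤ m) ∨ (3 ≤ d ∧ 3 ≤ m)) :
    ∃ C : ℝ, ∀ f e : Ray m → ℝ, EdgeBound d f e → (Function.support f).Finite →
      (Function.support e).Finite → f (zeroRay m) ^ 2 ≤ C * ∑ᶠ x, e x := by
  have hm : 2 ≤ m := by omega
  have hb : (⟨1, hm⟩ : Fin m) ≠ 0 := by
    rw [Ne, Fin.ext_iff]
    simp
  obtain ⟨B, hB, hscale⟩ := exists_scaleBound_of_degree h hb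
  obtain ⟨W, hW, hsum⟩ := exists_sum_rpow_le
  set b : Fin m := ⟨1, hm⟩
  refine ⟨2 + 4 * (B * W), fun f e he hf hes => ?_⟩
  have hE := fun n => cylSum_le_finsum he.nonneg hes n (zeroRay m)
  have hE0 : 0 ≤ ∑ᶠ x, e x := finsum_nonneg he.nonneg
  set E := ∑ᶠ x, e x
  have hz : consRay 0 (zeroRay m) = zeroRay m := appRay_replicate_zeroRay 1
  have h1 := he.head b 0 (zeroRay m)
  have h2 : e (consRay b (zeroRay m)) ≤ E :=
    (single_le_wordSum (A := Finset.univ) (y := [b])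
      (φ := fun y => e (appRay y (zeroRay m))) (by simp) fun y => he.nonneg _).trans (hE 1)
  rw [hz] at h1
  have h3 : f (consRay b (zeroRay m)) ^ 2 ≤ 2 * (B * W) * E := by
    have h4 (p : ℕ) : (f (consRay b (zeroRay m)) - cylMean f p (consRay b (zeroRay m))) ^ 2 ≤
        2 * (B * W) * E := by
      have h5 := sq_sub_le_of_ladder hb p.zero_le
        (T := fun j => B * ((j : ℝ) + 1) ^ (-(4 / 3) : ℝ)) (fun j => by positivity)
        (fun j _ => (hscale j).2) he (zeroRay m)
      rw [cylMean_zero, appRay_cons, appRay_replicate_zeroRay, Nat.Ico_zero_eq_range,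
        ← Finset.mul_sum] at h5
      refine h5.trans ?_
      have h6 := mul_le_mul_of_nonneg_left (hsum p) hB
      exact mul_le_mul (by linarith) (hE _) (cylSum_nonneg he.nonneg _ _) (by positivity)
    have h5 : Filter.Tendsto (fun p => cylMean f p (consRay b (zeroRay m))) Filter.atTop
        (nhds 0) := by
      refine squeeze_zero_norm (fun p => abs_cylMean_le hf p _) ?_
      have hm1 : (1 : ℝ) < m := by exact_mod_cast hm
      have := (tendsto_pow_atTop_nhds_zero_of_lt_one (r := (m : ℝ)⁻¹) (by positivity)
        (inv_lt_one_of_one_lt₀ hm1)).const_mul (∑ᶠ x, |f x|)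
      simpa [div_eq_mul_inv] using this
    have h6 := ((tendsto_const_nhds (x := f (consRay b (zeroRay m)))).sub h5).pow 2
    rw [sub_zero] at h6
    exact le_of_tendsto' h6 h4
  nlinarith [sq_nonneg (2 * f (consRay b (zeroRay m)) - f (zeroRay m))]

/-! ### A criterion for transience -/

/-- The contribution of the edges leaving `x` to the energy of `f`. -/
def energyDensity {ι X : Type*} [Fintype ι] (s : ι → Equiv.Perm X) (f : X → ℝ) (x : X) : ℝ :=
  ∑ i, (f (s i x) - f x) ^ 2

/-- The transition operator of the simple random walk on the Schreier graph of `s`. -/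
noncomputable def transitionOp {ι X : Type*} [Fintype ι] (s : ι → Equiv.Perm X) :
    Module.End ℝ (X → ℝ) :=
  (Fintype.card ι : ℝ)⁻¹ • ∑ i, LinearMap.funLeft ℝ ℝ (s i)

theorem transitionOp_apply {ι X : Type*} [Fintype ι] (s : ι → Equiv.Perm X) (f : X → ℝ) (x : X) :
    transitionOp s f x = (Fintype.card ι : ℝ)⁻¹ * ∑ i, f (s i x) := by
  simp [transitionOp, LinearMap.funLeft]

theorem energyDensity_nonneg {ι X : Type*} [Fintype ι] (s : ι → Equiv.Perm X) (f : X → ℝ)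
    (x : X) : 0 ≤ energyDensity s f x := Finset.sum_nonneg fun _ _ => sq_nonneg _

theorem finite_support_comp_perm {X : Type*} (σ : Equiv.Perm X) {f : X → ℝ}
    (hf : (Function.support f).Finite) : (Function.support fun x => f (σ x)).Finite :=
  hf.preimage σ.injective.injOn

theorem finite_support_energyDensity {ι X : Type*} [Fintype ι] (s : ι → Equiv.Perm X) {f : X → ℝ}
    (hf : (Function.support f).Finite) : (Function.support (energyDensity s f)).Finite := by
  refine ((Set.finite_iUnion fun i => finite_support_comp_perm (s i) hf).union hf).subset
    fun x hx => ?_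
  by_contra h
  simp only [Set.mem_union, Set.mem_iUnion, Function.mem_support, not_or, not_exists,
    not_not] at h
  exact hx (Finset.sum_eq_zero fun i _ => by simp [h.1 i, h.2])

theorem finite_support_transitionOp {ι X : Type*} [Fintype ι] (s : ι → Equiv.Perm X) {f : X → ℝ}
    (hf : (Function.support f).Finite) : (Function.support (transitionOp s f)).Finite := by
  refine (Set.finite_iUnion fun i => finite_support_comp_perm (s i) hf).subset fun x hx => ?_
  by_contra h
  simp only [Set.mem_iUnion, Function.mem_support, not_exists, not_not] at h
  exact hx (by simp [transitionOp_apply, h])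

/-- A permutation preserves the sum of f². Hence the Dirichlet identity holds for each generator
separately, without pairing it with its inverse. -/
theorem finsum_sq_sub_comp_perm {X : Type*} (σ : Equiv.Perm X) {f : X → ℝ}
    (hf : (Function.support f).Finite) :
    ∑ᶠ x, (f (σ x) - f x) ^ 2 = 2 * ∑ᶠ x, f x * (f x - f (σ x)) := by
  have hsq : (Function.support fun x => f x ^ 2).Finite :=
    hf.subset fun x hx h => hx (by simp [h])
  have hsq' : (Function.support fun x => f (σ x) ^ 2).Finite := finite_support_comp_perm σ hsq
  have h1 : ∑ᶠ x, f (σ x) ^ 2 = ∑ᶠ x, f x ^ 2 := finsum_comp_equiv σ (f := fun x => f x ^ 2)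
  have h2 : ∑ᶠ x, (f (σ x) - f x) ^ 2 =
      ∑ᶠ x, ((f (σ x) ^ 2 - f x ^ 2) + 2 * (f x * (f x - f (σ x)))) :=
    finsum_congr fun x => by ring
  rw [h2, finsum_add_distrib (f := fun x => f (σ x) ^ 2 - f x ^ 2) (g := fun x => 2 * (f x * (f x - f (σ x)))),
    finsum_sub_distrib hsq' hsq, h1, sub_self, zero_add, mul_finsum]
  · exact (hsq'.union hsq).subset fun x hx => by
      by_contra h
      simp only [Set.mem_union, Function.mem_support, not_or, not_not] at h
      exact hx (by simp only [h.1, h.2, sub_zero])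
  · exact hf.subset fun x hx h => hx (by simp [h])

theorem finsum_energyDensity {ι X : Type*} [Fintype ι] [Nonempty ι] (s : ι → Equiv.Perm X)
    {f : X → ℝ} (hf : (Function.support f).Finite) :
    ∑ᶠ x, energyDensity s f x =
      2 * Fintype.card ι * ∑ᶠ x, f x * (f x - transitionOp s f x) := by
  have hc : (Fintype.card ι : ℝ) ≠ 0 := by exact_mod_cast Fintype.card_ne_zero
  unfold energyDensity
  rw [finsum_sum_comm, Finset.sum_congr rfl fun i _ => finsum_sq_sub_comp_perm (s i) hf,
    ← Finset.mul_sum, ← finsum_sum_comm, mul_assoc]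
  · congr 1
    rw [mul_finsum]
    refine finsum_congr fun x => ?_
    rw [transitionOp_apply, ← Finset.mul_sum, Finset.sum_sub_distrib, Finset.sum_const,
      nsmul_eq_mul, Finset.card_univ]
    field_simp
  · exact fun i _ => hf.subset fun x hx h => hx (by simp [h])
  · exact fun i _ => ((finite_support_comp_perm (s i) hf).union hf).subset fun x hx => by
      by_contra h
      simp only [Set.mem_union, Function.mem_support, not_or, not_not] at h
      exact hx (by simp [h.1, h.2])

/-- `C` bounds the resistance from `x` to infinity. -/
def CapacityBound {ι X : Type*} [Fintype ι] (s : ι → Equiv.Perm X) (x : X) (C : ℝ) : Prop :=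
  ∀ f : X → ℝ, (Function.support f).Finite → f x ^ 2 ≤ C * ∑ᶠ z, energyDensity s f z

theorem finite_support_transitionOp_pow {ι X : Type*} [Fintype ι] (s : ι → Equiv.Perm X)
    {f : X → ℝ} (hf : (Function.support f).Finite) (n : ℕ) :
    (Function.support ((transitionOp s ^ n) f)).Finite := by
  induction n with
  | zero => simpa using hf
  | succ n ih => rw [pow_succ']; exact finite_support_transitionOp s ih

theorem transitionOp_pow_nonneg {ι X : Type*} [Fintype ι] (s : ι → Equiv.Perm X)
    {f : X → ℝ} (hf : ∀ x, 0 ≤ f x) (n : ℕ) (x : X) : 0 ≤ (transitionOp s ^ n) f x := by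
  induction n generalizing x with
  | zero => simpa using hf x
  | succ n ih =>
    rw [pow_succ', Module.End.mul_apply, transitionOp_apply]
    exact mul_nonneg (by positivity) (Finset.sum_nonneg fun i _ => ih _)

open Classical in
-- Test the resistance bound on the truncated Green function g. Its energy is at most c g(y), so the
-- bound at y gives g(y)² ≤ D c g(y). Thus g(y), and with it the energy, is bounded uniformly in N,
-- and the bound at x controls g(x).
theorem exists_sum_transitionOp_pow_le {ι X : Type*} [Fintype ι] [Nonempty ι]
    (s : ι → Equiv.Perm X) {x y : X} {C D : ℝ} (hC0 : 0 ≤ C) (hC : CapacityBound s x C)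
    (hD0 : 0 ≤ D) (hD : CapacityBound s y D) :
    ∃ A : ℝ, ∀ N, ∑ n ∈ Finset.range N, (transitionOp s ^ n) (Pi.single y 1) x ≤ A := by
  set c : ℝ := 2 * Fintype.card ι with hc
  have hc0 : 0 ≤ c := by positivity
  refine ⟨√(C * (c * (D * c))), fun N => ?_⟩
  set δ : X → ℝ := Pi.single y 1 with hδ
  have hδ0 : ∀ z, 0 ≤ δ z := fun z => by
    by_cases h : z = y
    · subst h; simp [hδ]
    · simp [hδ, h]
  have hδf : (Function.support δ).Finite :=
    (Set.finite_singleton y).subset Pi.support_single_subset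
  set g : X → ℝ := ∑ n ∈ Finset.range N, (transitionOp s ^ n) δ with hg
  have hgx (z : X) : g z = ∑ n ∈ Finset.range N, (transitionOp s ^ n) δ z := by
    simp [hg]
  have hg0 (z : X) : 0 ≤ g z := by
    rw [hgx]
    exact Finset.sum_nonneg fun n _ => transitionOp_pow_nonneg s hδ0 n z
  have hgf : (Function.support g).Finite := by
    refine ((Finset.range N).finite_toSet.biUnion fun n _ =>
      finite_support_transitionOp_pow s hδf n).subset fun z hz => ?_
    by_contra h
    simp only [Set.mem_iUnion, not_exists, Function.mem_support, not_not] at h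
    exact hz (by rw [hgx]; exact Finset.sum_eq_zero fun n hn => h n (by simpa using hn))
  -- Telescoping. The remainder is nonnegative and is dropped in the energy estimate.
  have h1 : g - transitionOp s g = δ - (transitionOp s ^ N) δ := by
    have h2 := Finset.sum_range_sub' (fun n => (transitionOp s ^ n) δ) N
    rw [hg, map_sum, ← Finset.sum_sub_distrib]
    simpa [pow_succ'] using h2
  have hE : ∑ᶠ z, energyDensity s g z ≤ c * g y := by
    rw [finsum_energyDensity s hgf]
    refine mul_le_mul_of_nonneg_left ?_ hc0
    have h2 : ∑ᶠ z, g z * δ z = g y := by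
      rw [finsum_eq_single _ y fun z hz => by simp [hδ, hz]]
      simp [hδ]
    rw [← h2]
    refine finsum_le_finsum' ?_ ?_ fun z => ?_
    · exact hgf.subset fun z hz h => hz (by simp [h])
    · exact hgf.subset fun z hz h => hz (by simp [h])
    · have h3 := congrFun h1 z
      simp only [Pi.sub_apply] at h3
      rw [h3]
      have := mul_nonneg (hg0 z) (transitionOp_pow_nonneg s hδ0 N z)
      linarith
  have hE0 : 0 ≤ ∑ᶠ z, energyDensity s g z := finsum_nonneg fun z => energyDensity_nonneg s g z
  have hgy : g y ≤ D * c := by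
    by_contra h
    push Not at h
    have hpos : 0 < g y := lt_of_le_of_lt (by positivity) h
    have h2 : g y ^ 2 ≤ D * (c * g y) :=
      (hD g hgf).trans (mul_le_mul_of_nonneg_left hE hD0)
    nlinarith
  rw [← hgx]
  refine Real.le_sqrt_of_sq_le ((hC g hgf).trans ?_)
  exact mul_le_mul_of_nonneg_left (hE.trans (mul_le_mul_of_nonneg_left hgy hc0)) hC0

/-! ### The law of the walk and powers of the transition operator -/

theorem schreierWalk_congr {ι V : Type*} (s : ι → Equiv.Perm V) (x : V) {ω ω' : ℕ → ι} {n : ℕ}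
    (h : ∀ k < n, ω k = ω' k) : schreierWalk s x ω n = schreierWalk s x ω' n := by
  induction n with
  | zero => rfl
  | succ n ih =>
    simp only [schreierWalk]
    rw [ih fun k hk => h k (by omega), h n (by omega)]

theorem setOf_schreierWalk_succ_eq {ι V : Type*} [Fintype ι] (s : ι → Equiv.Perm V) (x y : V)
    (n : ℕ) : {ω : ℕ → ι | schreierWalk s x ω (n + 1) = y} = ⋃ i ∈ (Finset.univ : Finset ι),
      ({ω | schreierWalk s x ω n = (s i)⁻¹ y} ∩ {ω | ω n = i}) := by
  ext ω
  simp [schreierWalk, Equiv.eq_symm_apply]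

theorem measurableSet_setOf_schreierWalk_eq {ι V : Type*} [Fintype ι] (s : ι → Equiv.Perm V)
    (x y : V) (n : ℕ) : @MeasurableSet _ (@MeasurableSpace.pi ℕ (fun _ => ι) fun _ => ⊤)
      {ω | schreierWalk s x ω n = y} := by
  induction n generalizing y with
  | zero => exact @MeasurableSet.const _ (@MeasurableSpace.pi ℕ (fun _ => ι) fun _ => ⊤) (x = y)
  | succ n ih =>
    rw [setOf_schreierWalk_succ_eq]
    exact Finset.measurableSet_biUnion _ fun i _ => (ih _).inter
      (@measurable_pi_apply ℕ (fun _ => ι) (fun _ => ⊤) n {i} trivial)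

theorem uniformLabels_inter_eq {ι V : Type*} [Fintype ι] [Nonempty ι] (s : ι → Equiv.Perm V)
    (x z : V) (n : ℕ) (i : ι) :
    uniformLabels ι ({ω | schreierWalk s x ω n = z} ∩ {ω | ω n = i}) =
      uniformLabels ι {ω | schreierWalk s x ω n = z} * (Fintype.card ι : ENNReal)⁻¹ := by
  classical
  let _ : MeasurableSpace ι := ⊤
  have : DiscreteMeasurableSpace ι := ⟨fun _ => trivial⟩
  set μ : Measure (ℕ → ι) := Measure.infinitePi fun _ : ℕ => (PMF.uniformOfFintype ι).toMeasure
    with hμ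
  change μ _ = μ _ * _
  have hind := (ProbabilityTheory.iIndepFun_infinitePi (Ω := fun _ : ℕ => ι)
    (P := fun _ : ℕ => (PMF.uniformOfFintype ι).toMeasure) (X := fun _ a => a)
    (fun _ => measurable_id)).indepFun_finset (Finset.range n) {n} (by simp)
      (fun k => measurable_pi_apply k)
  -- The position at time n depends only on the labels before n, so the later ones may be given any
  -- value; this exhibits the event in terms of the first n coordinates.
  let extend : (Finset.range n → ι) → ℕ → ι := fun v k =>
    if h : k ∈ Finset.range n then v ⟨k, h⟩ else Classical.arbitrary ι
  have hA : {ω : ℕ → ι | schreierWalk s x ω n = z} =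
      (fun (a : ℕ → ι) (k : Finset.range n) => a k) ⁻¹' {v | schreierWalk s x (extend v) n = z} := by
    ext ω
    simp only [Set.mem_ofPred_eq, Set.mem_preimage]
    rw [schreierWalk_congr s x (ω' := extend fun k => ω k) fun k hk => by
      simp [extend, hk]]
  have hB : {ω : ℕ → ι | ω n = i} =
      (fun (a : ℕ → ι) (k : ({n} : Finset ℕ)) => a k) ⁻¹'
        {v | v ⟨n, Finset.mem_singleton_self n⟩ = i} := rfl
  have h := hind.measure_inter_preimage_eq_mul _ _
    (MeasurableSet.of_discrete (s := {v : Finset.range n → ι | schreierWalk s x (extend v) n = z}))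
    (MeasurableSet.of_discrete
      (s := {v : ({n} : Finset ℕ) → ι | v ⟨n, Finset.mem_singleton_self n⟩ = i}))
  rw [← hμ, ← hA, ← hB] at h
  rw [h]
  congr 1
  have h1 : {ω : ℕ → ι | ω n = i} = (fun ω : ℕ → ι => ω n) ⁻¹' {i} := rfl
  rw [h1, (measurePreserving_eval_infinitePi
    (fun _ : ℕ => (PMF.uniformOfFintype ι).toMeasure) n).measure_preimage
      (MeasurableSet.of_discrete).nullMeasurableSet,
    PMF.toMeasure_apply_singleton _ _ MeasurableSet.of_discrete, PMF.uniformOfFintype_apply]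

open Classical in
-- Decompose by the last step: applied to the indicator of y, the transition operator averages the
-- indicators of the preimages of y.
theorem uniformLabels_schreierWalk_eq {ι V : Type*} [Fintype ι] [Nonempty ι]
    (s : ι → Equiv.Perm V) (x y : V) (n : ℕ) :
    uniformLabels ι {ω | schreierWalk s x ω n = y} =
      ENNReal.ofReal ((transitionOp s ^ n) (Pi.single y 1) x) := by
  induction n generalizing y with
  | zero =>
    let _ : MeasurableSpace ι := ⊤
    by_cases h : x = y
    · subst h
      have h1 : {ω : ℕ → ι | schreierWalk s x ω 0 = x} = Set.univ := by ext; simp [schreierWalk]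
      rw [h1]
      change (Measure.infinitePi fun _ : ℕ => (PMF.uniformOfFintype ι).toMeasure) _ = _
      simp
    · have h1 : {ω : ℕ → ι | schreierWalk s x ω 0 = y} = ∅ := by
        ext; simpa [schreierWalk] using h
      rw [h1]
      simp [h]
  | succ n ih =>
    have hcard : (0 : ℝ) < Fintype.card ι := by exact_mod_cast Fintype.card_pos
    have h2 : transitionOp s (Pi.single y (1 : ℝ)) =
        (Fintype.card ι : ℝ)⁻¹ • ∑ i, Pi.single ((s i)⁻¹ y) (1 : ℝ) := by
      funext z
      simp [transitionOp_apply, Pi.single_apply, Equiv.eq_symm_apply]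
    rw [setOf_schreierWalk_succ_eq, measure_biUnion_finset]
    · simp only [uniformLabels_inter_eq, ih]
      rw [pow_succ, Module.End.mul_apply, h2, map_smul, map_sum, Pi.smul_apply,
        Finset.sum_apply, smul_eq_mul, Finset.mul_sum,
        ENNReal.ofReal_sum_of_nonneg]
      · refine Finset.sum_congr rfl fun i _ => ?_
        rw [ENNReal.ofReal_mul (by positivity), mul_comm, ENNReal.ofReal_inv_of_pos hcard,
          ENNReal.ofReal_natCast]
      · intro i _
        refine mul_nonneg (by positivity) (transitionOp_pow_nonneg s (fun z => ?_) n x)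
        rw [Pi.single_apply]
        split_ifs <;> norm_num
    · intro i _ j _ hij
      refine Set.disjoint_left.2 fun ω hω hω' => hij ?_
      exact hω.2.symm.trans hω'.2
    · exact fun i _ => (measurableSet_setOf_schreierWalk_eq s x _ n).inter
        (@measurable_pi_apply ℕ (fun _ => ι) (fun _ => ⊤) n {i} trivial)

/-! ### Finite resistance throughout a component -/

theorem sq_sub_le_finsum_energyDensity {ι X : Type*} [Fintype ι] (s : ι → Equiv.Perm X)
    {f : X → ℝ} (hf : (Function.support f).Finite) (x : X) (i : ι) :
    (f (s i x) - f x) ^ 2 ≤ ∑ᶠ z, energyDensity s f z :=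
  (Finset.single_le_sum (f := fun i => (f (s i x) - f x) ^ 2) (fun _ _ => sq_nonneg _)
    (Finset.mem_univ i)).trans
      (single_le_finsum x (finite_support_energyDensity s hf) (energyDensity_nonneg s f))

theorem CapacityBound.of_adj {ι X : Type*} [Fintype ι] {s : ι → Equiv.Perm X} {x y : X} {C : ℝ}
    (h : CapacityBound s x C) (hxy : (schreierAdj s).Adj x y) :
    CapacityBound s y (2 * C + 2) := by
  intro f hf
  have h1 := h f hf
  have h2 : (f y - f x) ^ 2 ≤ ∑ᶠ z, energyDensity s f z := by
    obtain ⟨_, ⟨i, rfl⟩ | ⟨i, rfl⟩⟩ := hxy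
    · exact sq_sub_le_finsum_energyDensity s hf x i
    · rw [← neg_sub, neg_sq]
      exact sq_sub_le_finsum_energyDensity s hf y i
  nlinarith [sq_nonneg (f y - 2 * f x)]

theorem CapacityBound.exists_of_mem {ι X : Type*} [Fintype ι] {s : ι → Equiv.Perm X} {o : X}
    {C : ℝ} (hC : 0 ≤ C) (h : CapacityBound s o C) {x : X} (hx : x ∈ schreierComponent s o) :
    ∃ D : ℝ, 0 ≤ D ∧ CapacityBound s x D := by
  have hr : (schreierAdj s).Reachable o x := by
    rw [schreierComponent, SimpleGraph.ConnectedComponent.mem_supp_iff,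
      SimpleGraph.ConnectedComponent.eq] at hx
    exact hx.symm
  rw [SimpleGraph.reachable_iff_reflTransGen] at hr
  clear hx
  induction hr with
  | refl => exact ⟨C, hC, h⟩
  | tail _ hadj ih =>
    obtain ⟨D, hD, hD'⟩ := ih
    exact ⟨2 * D + 2, by positivity, hD'.of_adj hadj⟩

theorem coe_schreierWalk_schreierRestrict {ι X : Type*} (s : ι → Equiv.Perm X) (o : X)
    (x : schreierComponent s o) (ω : ℕ → ι) (n : ℕ) :
    (schreierWalk (schreierRestrict s o) x ω n).1 = schreierWalk s x.1 ω n := by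
  induction n with
  | zero => rfl
  | succ n ih =>
    simp only [schreierWalk]
    rw [← ih]
    rfl

/-- If the resistance from `o` to infinity is finite, then the component of `o` is transient. -/
theorem isTransientSchreier_schreierRestrict {ι X : Type*} [Fintype ι] [Nonempty ι]
    {s : ι → Equiv.Perm X} {o : X} {C : ℝ} (hC : 0 ≤ C) (h : CapacityBound s o C) :
    IsTransientSchreier (schreierRestrict s o) := by
  classical
  intro x y
  obtain ⟨C₁, hC₁, h₁⟩ := h.exists_of_mem hC x.2
  obtain ⟨C₂, hC₂, h₂⟩ := h.exists_of_mem hC y.2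
  obtain ⟨A, hA⟩ := exists_sum_transitionOp_pow_le s hC₁ h₁ hC₂ h₂
  have h0 (n : ℕ) : 0 ≤ (transitionOp s ^ n) (Pi.single (y : X) 1) x :=
    transitionOp_pow_nonneg s (fun z => by rw [Pi.single_apply]; split_ifs <;> norm_num) n x
  have hsum : Summable fun n => (transitionOp s ^ n) (Pi.single (y : X) 1) (x : X) :=
    summable_of_sum_range_le h0 hA
  -- Borel–Cantelli: the Green function is finite, so the visit probabilities are summable.
  refine ae_finite_setOfPred_mem
    (s := fun n => {ω | schreierWalk (schreierRestrict s o) x ω n = y}) ?_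
  have h3 (n : ℕ) : {ω | schreierWalk (schreierRestrict s o) x ω n = y} =
      {ω | schreierWalk s (x : X) ω n = y} := by
    ext ω
    simp only [Set.mem_ofPred_eq]
    rw [Subtype.ext_iff, coe_schreierWalk_schreierRestrict]
  simp only [h3, uniformLabels_schreierWalk_eq]
  exact hsum.tsum_ofReal_ne_top

/-! ### The moves of the mother group -/

theorem exists_motherAction_consRay (d : ℕ) {m : ℕ} [NeZero m] (c c' : Fin m) (t : Ray m) :
    ∃ g, motherAction d m g (consRay c t) = consRay c' t := by
  refine ⟨⟨0, firstLetterPerm m (Equiv.swap c c'), ⟨_, rfl⟩⟩, ?_⟩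
  funext i
  cases i <;> simp [motherAction, firstLetterPerm, consRay]

/-- The automorphism that acts by `τ` on the children of `b`, and fixes the other words. -/
def childAut {m : ℕ} [NeZero m] (b : Fin m) (τ : Equiv.Perm (Fin m)) : TwoLevelAut m :=
  ⟨(Equiv.refl (NonzeroLetter m)).prodShear fun x => if (x : Fin m) = b then τ else 1,
    fun _ _ => Iff.rfl⟩

theorem applyAt_childAut {m : ℕ} [NeZero m] (τ : Equiv.Perm (Fin m)) (v : Ray m) (p : ℕ)
    (hp : v p ≠ 0) :
    applyAt (childAut (v p) τ) v p hp = Function.update v (p + 1) (τ (v (p + 1))) := by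
  funext i
  by_cases h1 : i = p
  · subst h1
    simp [applyAt, childAut]
  · by_cases h2 : i = p + 1
    · subst h2
      simp [applyAt, childAut]
    · simp [applyAt, h1, h2]

theorem nonzeroPrefix_ne_zero {m k : ℕ} [NeZero m] {v : Ray m} {p : ℕ} (hv : IsNonzeroPos v k p)
    (j : Fin k) : nonzeroPrefix k v j ≠ 0 := by
  refine Nat.nth_mem (p := fun i => v i ≠ 0) j fun hf => ?_
  have hj : (j : ℕ) < Nat.count (fun i => v i ≠ 0) p := by rw [hv.2]; exact j.2
  exact hj.trans_le (Nat.count_le_card hf p)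

theorem levelHom_apply {m k : ℕ} [NeZero m] (g : (Fin k → Fin m) → TwoLevelAut m) (v : Ray m) :
    levelHom m k g v = levelMap g v := rfl

theorem lambdaPerm_apply_of_pos {m k : ℕ} [NeZero m] (w : Fin k → NonzeroLetter m)
    (σ : TwoLevelAut m) {v : Ray m} {p : ℕ} (hv : IsNonzeroPos v k p)
    (hw : nonzeroPrefix k v = fun j => (w j : Fin m)) :
    lambdaPerm w σ v = applyAt σ v p hv.1 := by
  rw [lambdaPerm, levelHom_apply, levelMap_of_pos _ hv, if_pos hw]

theorem exists_motherAction_update {d m k : ℕ} [NeZero m] (hk : k ≤ d) {v : Ray m} {p : ℕ}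
    (hv : IsNonzeroPos v k p) (c : Fin m) :
    ∃ g, motherAction d m g v = Function.update v (p + 1) c := by
  -- The word w is the actual prefix of v, and σ swaps two children of the letter at p, leaving that
  -- letter in place.
  let w : Fin k → NonzeroLetter m := fun j => ⟨nonzeroPrefix k v j, nonzeroPrefix_ne_zero hv j⟩
  let σ := childAut (v p) (Equiv.swap (v (p + 1)) c)
  have hmem : lambdaPerm w σ ∈ levelSubgroup m (k + 1) :=
    (le_iSup (fun w : Fin k → NonzeroLetter m => wordSubgroup w) w)
      (Subgroup.subset_closure ⟨σ, rfl⟩)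
  refine ⟨⟨⟨k + 1, by omega⟩, lambdaPerm w σ, hmem⟩, ?_⟩
  change lambdaPerm w σ v = _
  rw [lambdaPerm_apply_of_pos w σ hv rfl, applyAt_childAut, Equiv.swap_apply_left]

theorem appRay_length {m : ℕ} (y : List (Fin m)) (t : Ray m) (i : ℕ) :
    appRay y t (y.length + i) = t i := by
  induction y with
  | nil => simp
  | cons c y ih =>
    rw [List.length_cons, add_right_comm]
    exact ih

theorem count_appRay {m : ℕ} [NeZero m] (y : List (Fin m)) (t : Ray m) :
    Nat.count (fun i => appRay y t i ≠ 0) y.length = numNonzero y := by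
  induction y with
  | nil => exact Nat.count_zero _
  | cons c y ih =>
    rw [List.length_cons, Nat.count_succ']
    have h : (fun i => appRay (c :: y) t (i + 1) ≠ 0) = fun i => appRay y t i ≠ 0 := rfl
    simp only [numNonzero, List.countP_cons] at ih ⊢
    have h0 : appRay (c :: y) t 0 = c := rfl
    simp only [h0, decide_eq_true_eq]
    rw [← ih]
    rfl

theorem update_appRay {m : ℕ} (y : List (Fin m)) (b c c' : Fin m) (t : Ray m) :
    Function.update (appRay y (consRay b (consRay c t))) (y.length + 1) c' =
      appRay y (consRay b (consRay c' t)) := by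
  induction y with
  | nil =>
    funext i
    rcases i with _ | _ | i <;> simp [consRay, Function.update]
  | cons a y ih =>
    funext i
    cases i with
    | zero => simp [consRay, Function.update]
    | succ i =>
      have h := congrFun ih i
      simpa [consRay, Function.update] using h

theorem exists_motherAction_appRay {d m : ℕ} [NeZero m] (y : List (Fin m)) (b c c' : Fin m)
    (t : Ray m) (hy : numNonzero y ≤ d) (hb : b ≠ 0) :
    ∃ g, motherAction d m g (appRay y (consRay b (consRay c t))) =
      appRay y (consRay b (consRay c' t)) := by
  have hv : IsNonzeroPos (appRay y (consRay b (consRay c t))) (numNonzero y) y.length := by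
    refine ⟨?_, count_appRay y _⟩
    have h := appRay_length y (consRay b (consRay c t)) 0
    rw [add_zero] at h
    rw [h]
    exact hb
  obtain ⟨g, hg⟩ := exists_motherAction_update hy hv c'
  exact ⟨g, hg.trans (update_appRay y b c c' t)⟩

/-- Each move of `EdgeBound` is realised by a single generator, so its squared increment is one term
of the energy density. -/
theorem edgeBound_energyDensity (d m : ℕ) [NeZero m] (f : Ray m → ℝ) :
    EdgeBound d f (energyDensity (motherAction d m) f) := by
  have key {x y : Ray m} (h : ∃ g, motherAction d m g x = y) :
      (f x - f y) ^ 2 ≤ energyDensity (motherAction d m) f x := by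
    obtain ⟨g, rfl⟩ := h
    rw [← neg_sub, neg_sq]
    exact Finset.single_le_sum (f := fun g => (f (motherAction d m g x) - f x) ^ 2)
      (fun _ _ => sq_nonneg _) (Finset.mem_univ g)
  exact ⟨energyDensity_nonneg _ f, fun c c' t => key (exists_motherAction_consRay d c c' t),
    fun y b c c' t hy hb => key (exists_motherAction_appRay y b c c' t hy hb)⟩

theorem propositionp (d m : ℕ) [NeZero m] (h : (4 ≤ d ∧ 2 ≤ m) ∨ (3 ≤ d ∧ 3 ≤ m)) :
    IsTransientSchreier (fractalMotherGraph d m) := by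
  obtain ⟨C, hC⟩ := exists_sq_apply_zeroRay_le h
  refine isTransientSchreier_schreierRestrict (C := |C|) (abs_nonneg C) fun f hf => ?_
  refine (hC f _ (edgeBound_energyDensity d m f) hf
    (finite_support_energyDensity _ hf)).trans ?_
  exact mul_le_mul_of_nonneg_right (le_abs_self C)
    (finsum_nonneg fun z => energyDensity_nonneg _ f z)
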